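/- For a finite subset $A$ of an additive abelian group and an integer $k\ge 2$, let $kA=\{a_1+\dots+a_k : a_1,\dots,a_k\in A\}$ be the $k$-fold sumset and let $$E_k(A)=\bigl|\{(a_1,\dots,a_{2k})\in A^{2k} : a_1+\dots+a_k=a_{k+1}+\dots+a_{2k}\}\bigr|$$ be the $k$-additive energy of $A$; write $E(A)=E_2(A)$ for the additive energy. Let $d\ge 1$, $k\ge 2$, and $p=\log_{\frac{k+1}{2}}\binom{2k}{k}$, and regard $\{0,1\}^d$ as a subset of $\mathbb{Z}^d$. Then, for every nonempty $A\subseteq\{0,1\}^d$, $$E_k(A)\le\left(\frac{|kA|}{|A|}\right)^{p}.$$ Moreover, $p$ cannot be replaced by a smaller quantity: for every real $q<p$ there is a nonempty $A\subseteq\{0,1\}^d$ with $E_k(A)>\left(|kA|/|A|\right)^{q}$. In particular, for every nonempty $A\subseteq\{0,1\}^d$, $$E(A)\le\left(\frac{|A+A|}{|A|}\right)^{\log_{3/2}6}.$$ -/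

import Mathlib

open scoped Pointwise

/-- The discrete cube `{0,1}^d`, as a finite subset of `ℤ^d`. -/
def discreteCube (d : ℕ) : Finset (Fin d → ℤ) :=
  Fintype.piFinset fun _ => {0, 1}

/-- The `k`-fold sumset `kA = {a₁ + ⋯ + a_k : a₁, …, a_k ∈ A}` (not the dilate of `A`). -/
def iteratedSumset {G : Type*} [AddCommGroup G] [DecidableEq G] (k : ℕ) (A : Finset G) :
    Finset G :=
  (Fintype.piFinset fun _ : Fin k => A).image fun a => ∑ i, a i

/-- The `k`-additive energy `E_k(A)`: the number of `2k`-tuples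
`(a₁, …, a_k, b₁, …, b_k)` of elements of `A` with `a₁ + ⋯ + a_k = b₁ + ⋯ + b_k`. -/
def kAdditiveEnergy {G : Type*} [AddCommGroup G] [DecidableEq G] (k : ℕ) (A : Finset G) : ℕ :=
  (((Fintype.piFinset fun _ : Fin k => A) ×ˢ (Fintype.piFinset fun _ : Fin k => A)).filter
    fun x => ∑ i, x.1 i = ∑ i, x.2 i).card

/-! ### A single-crossing principle -/

/-! The ratio |kA|/|A| is compared with E_k(A) through |A| alone. Two bounds are proved for A in the
cube, both equalities for the full cube: E_k(A) ≤ |A|^P with P = log₂ C(2k,k)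
(`kAdditiveEnergy_le_card_rpow`), and |kA| ≥ |A|^(log₂(k+1)) (`card_rpow_le_card_iteratedSumset`).
The second gives |kA|/|A| ≥ |A|^(log₂((k+1)/2)); raising this to the power p and changing the base
of the logarithm gives the theorem, and the full cube shows that p is optimal.

Energy: E_k(A) is the 2k-th moment of the exponential sum of A, averaged over a finite torus of
roots of unity. A moment bound for arbitrary coefficients (`sum_norm_cubeSum_pow_le`) is proved by
induction on d: averaging over one coordinate produces the coefficients C(k,j)², Hölder bounds the
mixed moments, and the two-point inequality ∑ C(k,j)² a^(k-j) b^j ≤ (a^(k/P) + b^(k/P))^P closes the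
step.

Sumset: the induction needs k different sets. Let C_i and D_i be the union and the intersection of
the two slices of A_i. Every point of D_1 + ⋯ + D_m + C_(m+1) + ⋯ + C_k lifts to m+1 consecutive
slices of the sumset, so the sizes of these k+1 sets add up to at most the size of the sumset. With
t_i = |D_i|/|C_i|, sorted to be decreasing, what remains is `prod_one_add_rpow_le`. It follows from
the case of equal t_i, a bound for 1 + u + ⋯ + u^k, by equalising the weights one at a time.

Both one-variable inequalities are equalities at t = 0 and t = 1. With t = e^x, a failure between
these points forces the derivative numerator of the logarithmic gap to cross zero downwards and
later upwards. At a zero, a second-order differential equation turns the slope of the numerator into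
a difference of two sinh terms, and monotonicity of a ratio of sinh excludes that order of
crossings. -/

theorem exists_zero_of_crossing_up {N N' : ℝ → ℝ} (hN : ∀ x, HasDerivAt N (N' x) x) {a b : ℝ}
    (hab : a ≤ b) (ha : N a ≤ 0) (hb : 0 < N b) : ∃ x ∈ Set.Ico a b, N x = 0 ∧ 0 ≤ N' x := by
  by_contra! h
  have := image_le_of_deriv_right_lt_deriv_boundary (f := N) (f' := N') (a := a) (b := b)
    (B := fun _ => 0) (B' := fun _ => 0)
    (fun x _ => (hN x).continuousAt.continuousWithinAt) (fun x _ => (hN x).hasDerivWithinAt) ha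
    (fun x => hasDerivAt_const x 0) (fun x hx h0 => h x hx h0) (Set.right_mem_Icc.2 hab)
  exact absurd this (not_le.2 hb)

theorem exists_zero_of_crossing_down {N N' : ℝ → ℝ} (hN : ∀ x, HasDerivAt N (N' x) x) {a b : ℝ}
    (hab : a ≤ b) (ha : 0 ≤ N a) (hb : N b < 0) : ∃ x ∈ Set.Ico a b, N x = 0 ∧ N' x ≤ 0 := by
  obtain ⟨x, hx, h0, h1⟩ := exists_zero_of_crossing_up (N := fun x => - N x)
    (fun x => (hN x).neg) hab (by linarith) (by linarith)
  exact ⟨x, hx, by linarith, by linarith⟩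

/-- The quotient sinh(μx)/sinh(x) decreases on x > 0: the numerator of its derivative vanishes at 0
and has derivative (μ² - 1) sinh(μx) sinh(x) < 0. This is what forbids a downward crossing followed
by an upward one. -/
theorem sinh_mul_strict_ratio {μ : ℝ} (h0 : 0 < μ) (h1 : μ < 1) {s t : ℝ} (hs : 0 < s)
    (hst : s < t) : Real.sinh (μ * t) * Real.sinh s < Real.sinh (μ * s) * Real.sinh t := by
  have hd : ∀ x : ℝ, HasDerivAt (fun x => Real.sinh (μ * x)) (μ * Real.cosh (μ * x)) x := by
    intro x
    refine ((Real.hasDerivAt_sinh (μ * x)).comp x ((hasDerivAt_id x).const_mul μ)).congr_deriv ?_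
    simp only [mul_one]; ring
  have hd' : ∀ x : ℝ, HasDerivAt (fun x => μ * Real.cosh (μ * x))
      (μ * (μ * Real.sinh (μ * x))) x := by
    intro x
    refine (((Real.hasDerivAt_cosh (μ * x)).comp x
      ((hasDerivAt_id x).const_mul μ)).const_mul μ).congr_deriv ?_
    simp only [mul_one]; ring
  have hg : ∀ x : ℝ, 0 < x →
      μ * Real.cosh (μ * x) * Real.sinh x - Real.sinh (μ * x) * Real.cosh x < 0 := by
    have hder : ∀ x : ℝ, HasDerivAt
        (fun x => μ * Real.cosh (μ * x) * Real.sinh x - Real.sinh (μ * x) * Real.cosh x)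
        ((μ ^ 2 - 1) * (Real.sinh (μ * x) * Real.sinh x)) x := by
      intro x
      refine (((hd' x).mul (Real.hasDerivAt_sinh x)).sub
        ((hd x).mul (Real.hasDerivAt_cosh x))).congr_deriv ?_
      ring
    have hanti := strictAntiOn_of_deriv_neg (convex_Ici (0 : ℝ))
      (fun x _ => (hder x).continuousAt.continuousWithinAt) (fun x hx => by
        rw [interior_Ici] at hx
        rw [(hder x).deriv]
        have hx' : 0 < x := hx
        have := mul_pos (Real.sinh_pos_iff.2 (mul_pos h0 hx')) (Real.sinh_pos_iff.2 hx')
        exact mul_neg_of_neg_of_pos (by nlinarith) this)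
    intro x hx
    have := hanti Set.self_mem_Ici (Set.mem_Ici.2 hx.le) hx
    simpa using this
  have hder : ∀ x : ℝ, 0 < x → HasDerivAt (fun x => Real.sinh (μ * x) / Real.sinh x)
      ((μ * Real.cosh (μ * x) * Real.sinh x - Real.sinh (μ * x) * Real.cosh x)
        / Real.sinh x ^ 2) x :=
    fun x hx => (hd x).div (Real.hasDerivAt_sinh x) (Real.sinh_pos_iff.2 hx).ne'
  have hanti := strictAntiOn_of_deriv_neg (convex_Ioi (0 : ℝ))
    (fun x hx => (hder x hx).continuousAt.continuousWithinAt) (fun x hx => by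
      rw [interior_Ioi] at hx
      rw [(hder x hx).deriv]
      exact div_neg_of_neg_of_pos (hg x hx) (by have := Real.sinh_pos_iff.2 hx; positivity))
  have := hanti (Set.mem_Ioi.2 hs) (Set.mem_Ioi.2 (hs.trans hst)) hst
  exact (div_lt_div_iff₀ (Real.sinh_pos_iff.2 (hs.trans hst)) (Real.sinh_pos_iff.2 hs)).1 this

/-! ### Exponential sums and their moments -/

/-- The sum `∑_{j ≤ k} j ^ m c_j e^{j x}`, i.e. the `m`-th derivative of `∑_{j ≤ k} c_j e^{j x}`. -/
noncomputable def expMoment (c : ℕ → ℝ) (k m : ℕ) (x : ℝ) : ℝ :=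
  ∑ j ∈ Finset.range (k + 1), (j : ℝ) ^ m * c j * Real.exp (j * x)

theorem hasDerivAt_expMoment (c : ℕ → ℝ) (k m : ℕ) (x : ℝ) :
    HasDerivAt (expMoment c k m) (expMoment c k (m + 1) x) x := by
  unfold expMoment
  refine HasDerivAt.fun_sum fun j _ => ?_
  have := ((Real.hasDerivAt_exp (j * x)).comp x ((hasDerivAt_id x).const_mul (j : ℝ))).const_mul
    ((j : ℝ) ^ m * c j)
  refine this.congr_deriv ?_
  simp only [mul_one]; ring

theorem hasDerivAt_exp_mul (l x : ℝ) :
    HasDerivAt (fun x => Real.exp (l * x)) (l * Real.exp (l * x)) x := by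
  have := (Real.hasDerivAt_exp (l * x)).comp x ((hasDerivAt_id x).const_mul l)
  refine this.congr_deriv ?_
  simp only [mul_one]; ring

theorem one_le_expMoment_zero {c : ℕ → ℝ} (hc : ∀ j, 0 ≤ c j) (h0 : c 0 = 1) (k : ℕ) (x : ℝ) :
    1 ≤ expMoment c k 0 x := by
  unfold expMoment
  rw [Finset.sum_range_succ']
  have : 0 ≤ ∑ j ∈ Finset.range k, ((j + 1 : ℕ) : ℝ) ^ 0 * c (j + 1)
      * Real.exp ((j + 1 : ℕ) * x) :=
    Finset.sum_nonneg fun j _ => by have := hc (j + 1); positivity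
  simp only [h0, Nat.cast_zero, zero_mul, Real.exp_zero, pow_zero, mul_one] at this ⊢
  linarith

theorem tendsto_exp_mul_atBot {l : ℝ} (hl : 0 < l) :
    Filter.Tendsto (fun x => Real.exp (l * x)) Filter.atBot (nhds 0) :=
  Real.tendsto_exp_atBot.comp (Filter.tendsto_id.const_mul_atBot hl)

theorem tendsto_expMoment_zero_atBot {c : ℕ → ℝ} (h0 : c 0 = 1) (k : ℕ) :
    Filter.Tendsto (expMoment c k 0) Filter.atBot (nhds 1) := by
  have : Filter.Tendsto (expMoment c k 0) Filter.atBot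
      (nhds (∑ j ∈ Finset.range (k + 1), if j = 0 then 1 else 0)) := by
    unfold expMoment
    refine tendsto_finsetSum _ fun j _ => ?_
    rcases Nat.eq_zero_or_pos j with rfl | hj
    · simp [h0]
    · have := (tendsto_exp_mul_atBot (l := j) (by exact_mod_cast hj)).const_mul
        ((j : ℝ) ^ 0 * c j)
      simpa [hj.ne'] using this
  simpa using this

/-- The function comparing `log ∑ c_j e^{j x}` with `p log (1 + e^{l x})`. -/
noncomputable def logGap (c : ℕ → ℝ) (k : ℕ) (p l x : ℝ) : ℝ :=
  p * Real.log (1 + Real.exp (l * x)) - Real.log (expMoment c k 0 x)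

/-- The numerator of the derivative of `logGap`. -/
noncomputable def gapNum (c : ℕ → ℝ) (k : ℕ) (l x : ℝ) : ℝ :=
  k * Real.exp (l * x) * expMoment c k 0 x - (1 + Real.exp (l * x)) * expMoment c k 1 x

/-- The derivative of `gapNum`. -/
noncomputable def gapNumDeriv (c : ℕ → ℝ) (k : ℕ) (l x : ℝ) : ℝ :=
  k * (l * Real.exp (l * x)) * expMoment c k 0 x + k * Real.exp (l * x) * expMoment c k 1 x
    - (l * Real.exp (l * x) * expMoment c k 1 x + (1 + Real.exp (l * x)) * expMoment c k 2 x)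

theorem hasDerivAt_gapNum (c : ℕ → ℝ) (k : ℕ) (l x : ℝ) :
    HasDerivAt (gapNum c k l) (gapNumDeriv c k l x) x := by
  have he := hasDerivAt_exp_mul l x
  exact ((he.const_mul (k : ℝ)).mul (hasDerivAt_expMoment c k 0 x)).sub
    ((he.const_add 1).mul (hasDerivAt_expMoment c k 1 x))

theorem hasDerivAt_logGap {c : ℕ → ℝ} (hc : ∀ j, 0 ≤ c j) (h0 : c 0 = 1) {k : ℕ} {p l : ℝ}
    (hpl : p * l = k) (x : ℝ) : HasDerivAt (logGap c k p l)
    (gapNum c k l x / ((1 + Real.exp (l * x)) * expMoment c k 0 x)) x := by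
  have h1 := one_le_expMoment_zero hc h0 k x
  have h2 : 0 < 1 + Real.exp (l * x) := by positivity
  refine ((((hasDerivAt_exp_mul l x).const_add 1).log h2.ne').const_mul p |>.sub
    ((hasDerivAt_expMoment c k 0 x).log (by linarith))).congr_deriv ?_
  have h3 : expMoment c k 0 x ≠ 0 := by linarith
  unfold gapNum
  rw [← hpl]
  field_simp

theorem tendsto_logGap_atBot {c : ℕ → ℝ} (h0 : c 0 = 1) (k : ℕ) (p : ℝ) {l : ℝ} (hl : 0 < l) :
    Filter.Tendsto (logGap c k p l) Filter.atBot (nhds 0) := by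
  have h1 := ((tendsto_exp_mul_atBot hl).const_add 1).log (by norm_num)
  have h2 := (tendsto_expMoment_zero_atBot h0 k).log (by norm_num)
  simpa using! (h1.const_mul p).sub h2

/-- A negative value at x lies between the limit 0 at -∞ and the value 0 at the origin, so the mean
value theorem gives a negative slope to the left of x and a positive one to its right. -/
theorem exists_deriv_sign_of_neg {D N w : ℝ → ℝ} (hw : ∀ x, 0 < w x)
    (hD : ∀ x, HasDerivAt D (N x / w x) x) (hlim : Filter.Tendsto D Filter.atBot (nhds 0))
    (hD0 : D 0 = 0) {x : ℝ} (hx : x < 0) (hDx : D x < 0) :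
    (∃ b < x, N b < 0) ∧ ∃ e, x < e ∧ e < 0 ∧ 0 < N e := by
  have hcont : Continuous D := continuous_iff_continuousAt.2 fun x => (hD x).continuousAt
  constructor
  · obtain ⟨y, hy, hyx⟩ := ((hlim.eventually (lt_mem_nhds hDx)).and
      (Filter.eventually_lt_atBot x)).exists
    obtain ⟨b, hb, hbe⟩ := exists_hasDerivAt_eq_slope D _ hyx hcont.continuousOn
      (fun x _ => hD x)
    refine ⟨b, hb.2, ?_⟩
    have : N b / w b < 0 := by
      rw [hbe]; exact div_neg_of_neg_of_pos (by linarith) (by linarith)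
    by_contra! h
    exact absurd (div_nonneg h (hw b).le) (by linarith)
  · obtain ⟨b, hb, hbe⟩ := exists_hasDerivAt_eq_slope D _ hx hcont.continuousOn
      (fun x _ => hD x)
    refine ⟨b, hb.1, hb.2, ?_⟩
    have : 0 < N b / w b := by
      rw [hbe]; exact div_pos (by linarith) (by linarith)
    by_contra! h
    exact absurd (div_nonpos_of_nonpos_of_nonneg h (hw b).le) (by linarith)

/-! ### The two-point inequality for energies -/

/-- The hypergeometric equation of ∑ C(k,j)² t^j in the variable x = log t. It encodes the
recurrence (j+1) C(k,j+1) = (k-j) C(k,j), squared and summed. -/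
theorem expMoment_choose_sq_ode (k : ℕ) (x : ℝ) :
    (1 - Real.exp x) * expMoment (fun j => (k.choose j : ℝ) ^ 2) k 2 x
      = k ^ 2 * Real.exp x * expMoment (fun j => (k.choose j : ℝ) ^ 2) k 0 x
        - 2 * k * Real.exp x * expMoment (fun j => (k.choose j : ℝ) ^ 2) k 1 x := by
  have h1 : expMoment (fun j => (k.choose j : ℝ) ^ 2) k 2 x
      = Real.exp x * ∑ j ∈ Finset.range (k + 1),
        ((k : ℝ) - j) ^ 2 * (k.choose j : ℝ) ^ 2 * Real.exp (j * x) := by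
    unfold expMoment
    rw [Finset.sum_range_succ', Finset.sum_range_succ _ k]
    simp only [Nat.cast_zero, ne_eq, OfNat.ofNat_ne_zero, not_false_eq_true, zero_pow, zero_mul,
      add_zero, sub_self, Finset.mul_sum]
    refine Finset.sum_congr rfl fun j hj => ?_
    have hj' : j < k := Finset.mem_range.1 hj
    have h2 : ((j + 1 : ℕ) : ℝ) * (k.choose (j + 1)) = ((k : ℝ) - j) * k.choose j := by
      have := Nat.choose_succ_right_eq k j
      rw [← Nat.cast_sub hj'.le]
      have h3 : ((k.choose (j + 1) * (j + 1) : ℕ) : ℝ) = (k.choose j * (k - j) : ℕ) := by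
        rw [this]
      push_cast at h3 ⊢
      linarith
    have h4 : Real.exp (((j + 1 : ℕ) : ℝ) * x) = Real.exp x * Real.exp (j * x) := by
      rw [← Real.exp_add]; push_cast; ring_nf
    rw [h4, ← mul_pow, h2]; ring
  have h2 : ∑ j ∈ Finset.range (k + 1),
        ((k : ℝ) - j) ^ 2 * (k.choose j : ℝ) ^ 2 * Real.exp (j * x)
      = k ^ 2 * expMoment (fun j => (k.choose j : ℝ) ^ 2) k 0 x
        - 2 * k * expMoment (fun j => (k.choose j : ℝ) ^ 2) k 1 x
        + expMoment (fun j => (k.choose j : ℝ) ^ 2) k 2 x := by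
    unfold expMoment
    rw [Finset.mul_sum, Finset.mul_sum, ← Finset.sum_sub_distrib, ← Finset.sum_add_distrib]
    refine Finset.sum_congr rfl fun j _ => ?_
    ring
  rw [h2] at h1
  linear_combination h1

/-- The weight j(k+1-j) becomes (j+1)(k-j) under j ↦ j+1, and the boundary terms vanish; the shift
costs one factor e^x. -/
theorem expMoment_one_ode (k : ℕ) (x : ℝ) :
    (1 - Real.exp x) * expMoment (fun _ => 1) k 2 x
      = (k + 1) * expMoment (fun _ => 1) k 1 x - Real.exp x * (k * expMoment (fun _ => 1) k 0 x
        + (k - 1) * expMoment (fun _ => 1) k 1 x) := by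
  have h1 : ∑ j ∈ Finset.range (k + 1), ((j : ℝ) * (k + 1 - j)) * Real.exp (j * x)
      = Real.exp x * ∑ j ∈ Finset.range (k + 1),
        (((j : ℝ) + 1) * (k - j)) * Real.exp (j * x) := by
    rw [Finset.sum_range_succ', Finset.sum_range_succ _ k]
    simp only [Nat.cast_zero, zero_mul, add_zero, sub_self, mul_zero, Finset.mul_sum]
    refine Finset.sum_congr rfl fun j hj => ?_
    have h4 : Real.exp (((j + 1 : ℕ) : ℝ) * x) = Real.exp x * Real.exp (j * x) := by
      rw [← Real.exp_add]; push_cast; ring_nf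
    rw [h4]; push_cast; ring
  have h2 : ∑ j ∈ Finset.range (k + 1), ((j : ℝ) * (k + 1 - j)) * Real.exp (j * x)
      = (k + 1) * expMoment (fun _ => 1) k 1 x - expMoment (fun _ => 1) k 2 x := by
    unfold expMoment
    rw [Finset.mul_sum, ← Finset.sum_sub_distrib]
    exact Finset.sum_congr rfl fun j _ => by ring
  have h3 : ∑ j ∈ Finset.range (k + 1), (((j : ℝ) + 1) * (k - j)) * Real.exp (j * x)
      = k * expMoment (fun _ => 1) k 0 x + (k - 1) * expMoment (fun _ => 1) k 1 x
        - expMoment (fun _ => 1) k 2 x := by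
    unfold expMoment
    rw [Finset.mul_sum, Finset.mul_sum, ← Finset.sum_add_distrib, ← Finset.sum_sub_distrib]
    exact Finset.sum_congr rfl fun j _ => by ring
  rw [h2, h3] at h1
  linear_combination -h1

theorem exp_half_sinh (x a : ℝ) :
    2 * Real.exp (x / 2) * Real.sinh (a * (-x / 2))
      = Real.exp ((1 - a) / 2 * x) - Real.exp ((1 + a) / 2 * x) := by
  rw [Real.sinh_eq]
  have h1 : Real.exp ((1 - a) / 2 * x) = Real.exp (x / 2) * Real.exp (a * (-x / 2)) := by
    rw [← Real.exp_add]; ring_nf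
  have h2 : Real.exp ((1 + a) / 2 * x) = Real.exp (x / 2) * Real.exp (-(a * (-x / 2))) := by
    rw [← Real.exp_add]; ring_nf
  rw [h1, h2]; ring

/-- At a zero of `gapNum`, the sign of the derivative is that of a difference of two `sinh`. -/
theorem gapNumDeriv_choose_sq {k : ℕ} {l x : ℝ}
    (hN : gapNum (fun j => (k.choose j : ℝ) ^ 2) k l x = 0) :
    (1 + Real.exp (l * x)) * (1 - Real.exp x)
        * gapNumDeriv (fun j => (k.choose j : ℝ) ^ 2) k l x
      = (k * expMoment (fun j => (k.choose j : ℝ) ^ 2) k 0 x * Real.exp (l * x)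
          * (2 * Real.exp (x / 2))) *
        (l * Real.sinh (-x / 2) - k * Real.sinh ((2 * l - 1) * (-x / 2))) := by
  have hode := expMoment_choose_sq_ode k x
  have e1 := exp_half_sinh x 1
  have e2 := exp_half_sinh x (2 * l - 1)
  have hv : Real.exp ((1 - (2 * l - 1)) / 2 * x) * Real.exp (l * x) = Real.exp x := by
    rw [← Real.exp_add]; ring_nf
  have e3 : (1 + (2 * l - 1)) / 2 * x = l * x := by ring
  rw [e3] at e2
  simp only [one_mul, sub_self, zero_div, zero_mul, Real.exp_zero, one_add_one_eq_two,
    div_self (two_ne_zero' ℝ)] at e1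
  unfold gapNum at hN
  unfold gapNumDeriv
  set S0 := expMoment (fun j => (k.choose j : ℝ) ^ 2) k 0 x
  set S1 := expMoment (fun j => (k.choose j : ℝ) ^ 2) k 1 x
  set S2 := expMoment (fun j => (k.choose j : ℝ) ^ 2) k 2 x
  set v := Real.exp (l * x)
  set u := Real.exp x
  set r := Real.exp ((1 - (2 * l - 1)) / 2 * x)
  set A := Real.sinh (-x / 2)
  set B := Real.sinh ((2 * l - 1) * (-x / 2))
  set h := Real.exp (x / 2)
  have key : (k * S0 * v * (2 * h)) * (l * A - k * B) = k * S0 * v * (l * (1 - u) - k * (r - v)) := by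
    linear_combination (k * S0 * v * l) * e1 - (k * S0 * v * k) * e2
  rw [key]
  -- The differential equation eliminates the second moment, the vanishing of `gapNum` eliminates
  -- the first, and `hv` replaces r v by u.
  linear_combination (-(1 + v) ^ 2) * hode
    - ((1 - u) * (k - l) * v + 2 * k * u * (1 + v)) * hN + k ^ 2 * S0 * hv

theorem gapNumDeriv_one {k : ℕ} {l x : ℝ} (hN : gapNum (fun _ => 1) k l x = 0) :
    (1 + Real.exp (l * x)) * (1 - Real.exp x) * gapNumDeriv (fun _ => 1) k l x
      = (k * expMoment (fun _ => 1) k 0 x * Real.exp (l * x) * (2 * Real.exp (x / 2))) *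
        (Real.sinh ((2 * l - 1) * (-x / 2)) - (k + 1 - l) * Real.sinh (-x / 2)) := by
  have hode := expMoment_one_ode k x
  have e1 := exp_half_sinh x 1
  have e2 := exp_half_sinh x (2 * l - 1)
  have hv : Real.exp ((1 - (2 * l - 1)) / 2 * x) * Real.exp (l * x) = Real.exp x := by
    rw [← Real.exp_add]; ring_nf
  have e3 : (1 + (2 * l - 1)) / 2 * x = l * x := by ring
  rw [e3] at e2
  simp only [one_mul, sub_self, zero_div, zero_mul, Real.exp_zero, one_add_one_eq_two,
    div_self (two_ne_zero' ℝ)] at e1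
  unfold gapNum at hN
  unfold gapNumDeriv
  set S0 := expMoment (fun _ => 1) k 0 x
  set S1 := expMoment (fun _ => 1) k 1 x
  set S2 := expMoment (fun _ => 1) k 2 x
  set v := Real.exp (l * x)
  set u := Real.exp x
  set r := Real.exp ((1 - (2 * l - 1)) / 2 * x)
  set A := Real.sinh (-x / 2)
  set B := Real.sinh ((2 * l - 1) * (-x / 2))
  set h := Real.exp (x / 2)
  have key : (k * S0 * v * (2 * h)) * (B - (k + 1 - l) * A)
      = k * S0 * v * ((r - v) - (k + 1 - l) * (1 - u)) := by
    linear_combination (-(k * S0 * v * (k + 1 - l))) * e1 + (k * S0 * v) * e2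
  rw [key]
  linear_combination (-(1 + v) ^ 2) * hode
    - ((1 - u) * (k - l) * v - (1 + v) * (k + 1 - u * (k - 1))) * hN - k * S0 * hv

theorem sign_of_mul_eq_mul {a b c d : ℝ} (ha : 0 < a) (hc : 0 < c) (h : a * b = c * d) :
    (0 ≤ b → 0 ≤ d) ∧ (b ≤ 0 → d ≤ 0) := by
  constructor
  · intro hb
    exact nonneg_of_mul_nonneg_right (h ▸ mul_nonneg ha.le hb) hc
  · intro hb
    by_contra! hd
    have := mul_pos hc hd
    rw [← h] at this
    exact absurd (mul_nonpos_of_nonneg_of_nonpos ha.le hb) (not_le.2 this)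

/-- Near -∞ the positive term of `gapNum` is at least k e^(lx), while the negative one is O(e^x),
the index 0 contributing nothing to the first moment. Since l < 1, the positive term wins. -/
theorem exists_gapNum_pos {c : ℕ → ℝ} (hc : ∀ j, 0 ≤ c j) (h0 : c 0 = 1) {k : ℕ} (hk : 1 ≤ k)
    {l : ℝ} (hl : 0 < l) (hl1 : l < 1) {b : ℝ} (hb : b ≤ 0) : ∃ a < b, 0 < gapNum c k l a := by
  set C : ℝ := ∑ j ∈ Finset.range (k + 1), (j : ℝ) * c j with hC
  have hS1 : ∀ x ≤ 0, expMoment c k 1 x ≤ C * Real.exp x := by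
    intro x hx
    unfold expMoment
    rw [hC, Finset.sum_mul]
    refine Finset.sum_le_sum fun j _ => ?_
    rcases Nat.eq_zero_or_pos j with rfl | hj
    · simp
    · rw [pow_one]
      have h1 : Real.exp (j * x) ≤ Real.exp x := by
        have : (1 : ℝ) ≤ j := by exact_mod_cast hj
        exact Real.exp_le_exp.2 (by nlinarith)
      exact mul_le_mul_of_nonneg_left h1 (mul_nonneg j.cast_nonneg (hc j))
  have hk0 : (0 : ℝ) < k := by exact_mod_cast hk
  have hlim := (tendsto_exp_mul_atBot (l := 1 - l) (by linarith)).const_mul (2 * C)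
  rw [mul_zero] at hlim
  obtain ⟨a, ha, hab⟩ := ((hlim.eventually (gt_mem_nhds hk0)).and
    (Filter.eventually_lt_atBot b)).exists
  refine ⟨a, hab, ?_⟩
  have ha0 : a ≤ 0 := by linarith
  have h1 := one_le_expMoment_zero hc h0 k a
  have h2 := hS1 a ha0
  have hv : Real.exp (l * a) ≤ 1 := Real.exp_le_one_iff.2 (mul_nonpos_of_nonneg_of_nonpos hl.le ha0)
  have hv0 := Real.exp_pos (l * a)
  have hu : Real.exp a = Real.exp (l * a) * Real.exp ((1 - l) * a) := by
    rw [← Real.exp_add]; ring_nf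
  have hS1' : 0 ≤ expMoment c k 1 a :=
    Finset.sum_nonneg fun j _ => by have := hc j; positivity
  unfold gapNum
  have h3 : (1 + Real.exp (l * a)) * expMoment c k 1 a
      ≤ 2 * (C * (Real.exp (l * a) * Real.exp ((1 - l) * a))) := by
    rw [← hu]
    exact mul_le_mul (by linarith) h2 hS1' (by norm_num)
  have h4 : k * Real.exp (l * a) ≤ k * Real.exp (l * a) * expMoment c k 0 a :=
    le_mul_of_one_le_right (by positivity) h1
  have h5 := mul_lt_mul_of_pos_right ha hv0
  linarith

/-- `gapNum` vanishes at 0 with derivative -k(k+1)(k+2-3l)/6, negative by `hl`, so it is positive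
just to the left of 0. -/
theorem exists_gapNum_one_pos {k : ℕ} (hk : 1 ≤ k) {l : ℝ} (hl : 3 * l < k + 2) {e : ℝ}
    (he : e < 0) : ∃ a, e < a ∧ a < 0 ∧ 0 < gapNum (fun _ => 1) k l a := by
  have hS0 : expMoment (fun _ => 1) k 0 0 = k + 1 := by simp [expMoment]
  have hS1 : expMoment (fun _ => 1) k 1 0 = k * (k + 1) / 2 := by
    simp only [expMoment, pow_one, mul_one, mul_zero, Real.exp_zero]
    clear hk hl hS0
    induction k with
    | zero => simp
    | succ n ih => rw [Finset.sum_range_succ, ih]; push_cast; ring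
  have hS2 : expMoment (fun _ => 1) k 2 0 = k * (k + 1) * (2 * k + 1) / 6 := by
    simp only [expMoment, mul_one, mul_zero, Real.exp_zero]
    clear hk hl hS0 hS1
    induction k with
    | zero => simp
    | succ n ih => rw [Finset.sum_range_succ, ih]; push_cast; ring
  have hk0 : (0 : ℝ) < k := by exact_mod_cast hk
  have hN0 : gapNum (fun _ => 1) k l 0 = 0 := by
    simp only [gapNum, hS0, hS1, mul_zero, Real.exp_zero]; ring
  have hN1 : gapNumDeriv (fun _ => 1) k l 0 < 0 := by
    have : gapNumDeriv (fun _ => 1) k l 0 = -(k * (k + 1) * (k + 2 - 3 * l) / 6) := by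
      simp only [gapNumDeriv, hS0, hS1, hS2, mul_zero, Real.exp_zero]; ring
    rw [this]
    have h1 : (0 : ℝ) < k + 2 - 3 * l := by linarith
    have : (0 : ℝ) < k * (k + 1) * (k + 2 - 3 * l) / 6 := by positivity
    linarith
  have hs := (hasDerivAt_iff_tendsto_slope.1 (hasDerivAt_gapNum (fun _ => 1) k l 0)).mono_left
    (nhdsWithin_mono 0 (s := Set.Iio 0) fun x hx => ne_of_lt hx)
  obtain ⟨a, ha, ha'⟩ := ((hs.eventually (gt_mem_nhds hN1)).and
    (Ioo_mem_nhdsLT he)).exists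
  refine ⟨a, ha'.1, ha'.2, ?_⟩
  rw [slope_def_field, hN0, sub_zero, sub_zero] at ha
  by_contra! h
  exact absurd (div_nonneg_of_nonpos h ha'.2.le) (not_le.2 ha)

theorem logGap_choose_sq_nonneg {k : ℕ} (hk : 1 ≤ k) {p l : ℝ} (hpl : p * l = k)
    (hl : 1 / 2 < l) (hl1 : l < 1)
    (h0 : logGap (fun j => (k.choose j : ℝ) ^ 2) k p l 0 = 0) {x : ℝ} (hx : x < 0) :
    0 ≤ logGap (fun j => (k.choose j : ℝ) ^ 2) k p l x := by
  by_contra! hneg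
  set c : ℕ → ℝ := fun j => (k.choose j : ℝ) ^ 2 with hcdef
  have hc : ∀ j, 0 ≤ c j := fun j => by positivity
  have hc0 : c 0 = 1 := by simp [c]
  have hS : ∀ x, 1 ≤ expMoment c k 0 x := one_le_expMoment_zero hc hc0 k
  have hk0 : (0 : ℝ) < k := by exact_mod_cast hk
  obtain ⟨⟨b, hbx, hb⟩, e, hxe, he0, he⟩ := exists_deriv_sign_of_neg
    (N := gapNum c k l) (w := fun x => (1 + Real.exp (l * x)) * expMoment c k 0 x)
    (fun x => by have := hS x; positivity)
    (hasDerivAt_logGap hc hc0 hpl) (tendsto_logGap_atBot hc0 k p (by linarith)) h0 hx hneg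
  -- The signs +, -, + at a < b < e yield a downward zero y followed by an upward zero z.
  obtain ⟨a, hab, ha⟩ : ∃ a < b, 0 < gapNum c k l a :=
    exists_gapNum_pos hc hc0 hk (by linarith) hl1 (by linarith)
  have hN := hasDerivAt_gapNum c k l
  obtain ⟨y, hy, hy0, hy1⟩ := exists_zero_of_crossing_down hN hab.le ha.le hb
  obtain ⟨z, hz, hz0, hz1⟩ := exists_zero_of_crossing_up hN (hbx.trans hxe).le hb.le he
  have hyz : y < z := lt_of_lt_of_le hy.2 hz.1
  have hzneg : z < 0 := hz.2.trans he0
  have sgn : ∀ x < 0, gapNum c k l x = 0 →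
      (0 ≤ gapNumDeriv c k l x → 0 ≤ l * Real.sinh (-x / 2)
        - k * Real.sinh ((2 * l - 1) * (-x / 2))) ∧
      (gapNumDeriv c k l x ≤ 0 → l * Real.sinh (-x / 2)
        - k * Real.sinh ((2 * l - 1) * (-x / 2)) ≤ 0) := by
    intro x hx hx0
    have h1 : 0 < 1 - Real.exp x := by linarith [Real.exp_lt_one_iff.2 hx]
    have h2 := hS x
    exact sign_of_mul_eq_mul (by positivity) (by positivity) (gapNumDeriv_choose_sq hx0)
  have s1 := (sgn y (hyz.trans hzneg) hy0).2 hy1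
  have s2 := (sgn z hzneg hz0).1 hz1
  -- The slopes say that sinh(μs)/sinh(s) is at least l/k at s = -y/2 and at most l/k at the smaller
  -- point s = -z/2, against its strict decrease.
  have s3 := sinh_mul_strict_ratio (μ := 2 * l - 1) (by linarith) (by linarith)
    (s := -z / 2) (t := -y / 2) (by linarith) (by linarith)
  have p1 : 0 < Real.sinh (-z / 2) := Real.sinh_pos_iff.2 (by linarith)
  have p2 : 0 < Real.sinh (-y / 2) := Real.sinh_pos_iff.2 (by linarith)
  have t1 := mul_le_mul_of_nonneg_right (sub_nonpos.1 s1) p1.le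
  have t2 := mul_le_mul_of_nonneg_right (sub_nonneg.1 s2) p2.le
  have t3 := mul_lt_mul_of_pos_left s3 hk0
  linarith

theorem logGap_one_nonpos {k : ℕ} (hk : 1 ≤ k) {p l : ℝ} (hpl : p * l = k)
    (hl : 1 < l) (hl1 : 3 * l < k + 2)
    (h0 : logGap (fun _ => 1) k p l 0 = 0) {x : ℝ} (hx : x < 0) :
    logGap (fun _ => 1) k p l x ≤ 0 := by
  by_contra! hneg
  set c : ℕ → ℝ := fun _ => 1 with hcdef
  have hc : ∀ j, 0 ≤ c j := fun j => zero_le_one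
  have hc0 : c 0 = 1 := rfl
  have hS : ∀ x, 1 ≤ expMoment c k 0 x := one_le_expMoment_zero hc hc0 k
  have hk0 : (0 : ℝ) < k := by exact_mod_cast hk
  have hlim := (tendsto_logGap_atBot hc0 k p (l := l) (by linarith)).neg
  rw [neg_zero] at hlim
  obtain ⟨⟨b, hbx, hb⟩, e, hxe, he0, he⟩ := exists_deriv_sign_of_neg
    (D := fun x => - logGap c k p l x)
    (N := fun x => - gapNum c k l x) (w := fun x => (1 + Real.exp (l * x)) * expMoment c k 0 x)
    (fun x => by have := hS x; positivity)
    (fun x => by simpa only [neg_div] using (hasDerivAt_logGap hc hc0 hpl x).fun_neg)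
    hlim (by rw [h0, neg_zero]) hx (by linarith)
  obtain ⟨a, hab, ha0, ha⟩ : ∃ a, e < a ∧ a < 0 ∧ 0 < gapNum c k l a :=
    exists_gapNum_one_pos hk hl1 he0
  have hN := hasDerivAt_gapNum c k l
  obtain ⟨y, hy, hy0, hy1⟩ := exists_zero_of_crossing_down hN (hbx.trans hxe).le
    (by linarith) (neg_pos.1 he)
  obtain ⟨z, hz, hz0, hz1⟩ := exists_zero_of_crossing_up hN hab.le (by linarith) ha
  have hyz : y < z := lt_of_lt_of_le hy.2 hz.1
  have hzneg : z < 0 := hz.2.trans ha0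
  have sgn : ∀ x < 0, gapNum c k l x = 0 →
      (0 ≤ gapNumDeriv c k l x → 0 ≤ Real.sinh ((2 * l - 1) * (-x / 2))
        - (k + 1 - l) * Real.sinh (-x / 2)) ∧
      (gapNumDeriv c k l x ≤ 0 → Real.sinh ((2 * l - 1) * (-x / 2))
        - (k + 1 - l) * Real.sinh (-x / 2) ≤ 0) := by
    intro x hx hx0
    have h1 : 0 < 1 - Real.exp x := by linarith [Real.exp_lt_one_iff.2 hx]
    have h2 := hS x
    exact sign_of_mul_eq_mul (by positivity) (by positivity) (gapNumDeriv_one hx0)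
  have s1 := (sgn y (hyz.trans hzneg) hy0).2 hy1
  have s2 := (sgn z hzneg hz0).1 hz1
  have hμ : 0 < 2 * l - 1 := by linarith
  -- Here 2l - 1 > 1, so the ratio lemma is used with the inverse parameter at rescaled arguments.
  have s3 := sinh_mul_strict_ratio (μ := (2 * l - 1)⁻¹) (by positivity)
    (inv_lt_one_of_one_lt₀ (by linarith))
    (s := (2 * l - 1) * (-z / 2)) (t := (2 * l - 1) * (-y / 2))
    (mul_pos hμ (by linarith)) (mul_lt_mul_of_pos_left (by linarith) hμ)
  rw [inv_mul_cancel_left₀ hμ.ne', inv_mul_cancel_left₀ hμ.ne'] at s3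
  have p1 : 0 < Real.sinh (-z / 2) := Real.sinh_pos_iff.2 (by linarith)
  have p2 : 0 < Real.sinh (-y / 2) := Real.sinh_pos_iff.2 (by linarith)
  have t1 := mul_le_mul_of_nonneg_right (sub_nonpos.1 s1) p1.le
  have t2 := mul_le_mul_of_nonneg_right (sub_nonneg.1 s2) p2.le
  linarith

theorem expMoment_zero_log (c : ℕ → ℝ) (k : ℕ) {t : ℝ} (ht : 0 < t) :
    expMoment c k 0 (Real.log t) = ∑ j ∈ Finset.range (k + 1), c j * t ^ j := by
  refine Finset.sum_congr rfl fun j _ => ?_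
  rw [← Real.log_pow, Real.exp_log (pow_pos ht j), pow_zero, one_mul]

theorem exp_mul_log {t : ℝ} (ht : 0 < t) (l : ℝ) : Real.exp (l * Real.log t) = t ^ l := by
  rw [Real.rpow_def_of_pos ht, mul_comm]

theorem sum_choose_sq (k : ℕ) :
    ∑ j ∈ Finset.range (k + 1), ((k.choose j : ℕ) : ℝ) ^ 2 = ((2 * k).choose k : ℕ) := by
  rw [← Nat.sum_range_choose_sq]; push_cast; rfl

theorem two_pow_lt_choose_two_mul {k : ℕ} (hk : 2 ≤ k) : 2 ^ k < (2 * k).choose k := by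
  induction k, hk using Nat.le_induction with
  | base => decide
  | succ n hn ih =>
    have h := Nat.succ_mul_centralBinom_succ n
    simp only [Nat.centralBinom_eq_two_mul_choose] at h
    have h2 : (n + 1) * 2 ^ (n + 1) < (n + 1) * (2 * (n + 1)).choose (n + 1) := by
      rw [h, pow_succ]
      nlinarith
    exact lt_of_mul_lt_mul_left h2 (Nat.zero_le _)

/-- The exponent `log₂ (2k choose k)` lies strictly between `k` and `2k`. -/
theorem lt_logb_choose {k : ℕ} (hk : 2 ≤ k) :
    (k : ℝ) < Real.logb 2 ((2 * k).choose k : ℕ) ∧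
      Real.logb 2 ((2 * k).choose k : ℕ) < 2 * k := by
  have h1 := two_pow_lt_choose_two_mul hk
  have h2 := Nat.centralBinom_lt_four_pow (n := k) (by omega)
  rw [Nat.centralBinom_eq_two_mul_choose] at h2
  have h0 : (0 : ℝ) < ((2 * k).choose k : ℕ) := by
    exact_mod_cast Nat.choose_pos (by omega)
  constructor
  · rw [Real.lt_logb_iff_rpow_lt one_lt_two h0, Real.rpow_natCast]
    exact_mod_cast h1
  · rw [Real.logb_lt_iff_lt_rpow one_lt_two h0]
    have : (2 : ℝ) ^ (2 * (k : ℝ)) = 4 ^ k := by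
      rw [Real.rpow_mul (by norm_num), Real.rpow_natCast]; norm_num
    rw [this]
    exact_mod_cast h2

theorem sum_choose_sq_mul_pow_le_of_le_one {k : ℕ} (hk : 2 ≤ k) {p : ℝ}
    (hp : p = Real.logb 2 ((2 * k).choose k : ℕ)) {t : ℝ} (ht0 : 0 ≤ t) (ht1 : t ≤ 1) :
    ∑ j ∈ Finset.range (k + 1), (k.choose j : ℝ) ^ 2 * t ^ j ≤ (1 + t ^ (k / p)) ^ p := by
  obtain ⟨hkp, hpk⟩ := lt_logb_choose hk
  rw [← hp] at hkp hpk
  have hk0 : (0 : ℝ) < k := by exact_mod_cast (by omega : 0 < k)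
  have hp0 : 0 < p := hk0.trans hkp
  have hC : (0 : ℝ) < ((2 * k).choose k : ℕ) := by
    exact_mod_cast Nat.choose_pos (by omega)
  have h2p : (2 : ℝ) ^ p = ((2 * k).choose k : ℕ) := by
    rw [hp, Real.rpow_logb two_pos (by norm_num) hC]
  rcases ht0.eq_or_lt with rfl | ht0
  · rw [Real.zero_rpow (by positivity), add_zero, Real.one_rpow, Finset.sum_range_succ']
    simp
  rcases ht1.eq_or_lt with rfl | ht1
  · simp only [one_pow, mul_one, Real.one_rpow, sum_choose_sq, one_add_one_eq_two, h2p, le_refl]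
  have hl0 : logGap (fun j => (k.choose j : ℝ) ^ 2) k p (k / p) 0 = 0 := by
    have : expMoment (fun j => (k.choose j : ℝ) ^ 2) k 0 0 = ((2 * k).choose k : ℕ) := by
      rw [← sum_choose_sq]; simp [expMoment]
    rw [logGap, this, mul_zero, Real.exp_zero, one_add_one_eq_two, ← h2p, Real.log_rpow two_pos,
      sub_self]
  have := logGap_choose_sq_nonneg (k := k) (by omega) (p := p) (l := k / p)
    (mul_div_cancel₀ _ hp0.ne') (by rw [div_lt_div_iff₀ two_pos hp0]; linarith)
    (by rwa [div_lt_one hp0]) hl0 (Real.log_neg ht0 ht1)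
  rw [logGap, exp_mul_log ht0, expMoment_zero_log _ _ ht0, sub_nonneg] at this
  have hpos : (0 : ℝ) < ∑ j ∈ Finset.range (k + 1), (k.choose j : ℝ) ^ 2 * t ^ j := by
    rw [Finset.sum_range_succ']
    have : 0 ≤ ∑ j ∈ Finset.range k, (k.choose (j + 1) : ℝ) ^ 2 * t ^ (j + 1) := by positivity
    simp only [Nat.choose_zero_right, Nat.cast_one, one_pow, pow_zero, mul_one]
    linarith
  rw [← Real.log_rpow (by positivity)] at this
  exact (Real.log_le_log_iff hpos (by positivity)).1 this

/-- The two-point inequality behind the bound for the `k`-additive energy. -/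
theorem sum_choose_sq_mul_pow_mul_pow_le {k : ℕ} (hk : 2 ≤ k) {p : ℝ}
    (hp : p = Real.logb 2 ((2 * k).choose k : ℕ)) {a b : ℝ} (ha : 0 ≤ a) (hb : 0 ≤ b) :
    ∑ j ∈ Finset.range (k + 1), (k.choose j : ℝ) ^ 2 * (a ^ (k - j) * b ^ j)
      ≤ (a ^ (k / p) + b ^ (k / p)) ^ p := by
  wlog hab : b ≤ a generalizing a b
  -- Both sides are symmetric in a and b, by the reflection j ↦ k - j; then homogeneity reduces to t
  -- = b/a ≤ 1.
  · rw [add_comm (a ^ (k / p : ℝ))]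
    refine le_trans (le_of_eq ?_) (this hb ha (not_le.1 hab).le)
    rw [← Finset.sum_range_reflect]
    refine Finset.sum_congr rfl fun j hj => ?_
    have hj' : j ≤ k := Nat.lt_succ_iff.1 (Finset.mem_range.1 hj)
    rw [show k + 1 - 1 - j = k - j by omega, Nat.choose_symm hj', Nat.sub_sub_self hj',
      mul_comm (a ^ _)]
  obtain ⟨hkp, hpk⟩ := lt_logb_choose hk
  rw [← hp] at hkp hpk
  have hk0 : (0 : ℝ) < k := by exact_mod_cast (by omega : 0 < k)
  have hp0 : 0 < p := hk0.trans hkp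
  rcases ha.eq_or_lt with rfl | ha
  · obtain rfl : b = 0 := le_antisymm hab hb
    rw [Real.zero_rpow (by positivity), add_zero, Real.zero_rpow hp0.ne']
    refine (Finset.sum_eq_zero fun j hj => ?_).le
    rw [← pow_add, zero_pow, mul_zero]
    have := Finset.mem_range.1 hj
    omega
  have h := sum_choose_sq_mul_pow_le_of_le_one hk hp (div_nonneg hb ha.le)
    ((div_le_one ha).2 hab)
  have h2 := mul_le_mul_of_nonneg_left h (pow_nonneg ha.le k)
  have h3 : a ^ k = (a ^ (k / p : ℝ)) ^ p := by
    rw [← Real.rpow_mul ha.le, div_mul_cancel₀ _ hp0.ne', Real.rpow_natCast]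
  refine le_trans (le_of_eq ?_) (h2.trans (le_of_eq ?_))
  · rw [Finset.mul_sum]
    refine Finset.sum_congr rfl fun j hj => ?_
    have hj' : j ≤ k := Nat.lt_succ_iff.1 (Finset.mem_range.1 hj)
    have : a ^ k = a ^ (k - j) * a ^ j := by rw [← pow_add]; congr 1; omega
    rw [this, div_pow]
    field_simp
  · rw [h3, ← Real.mul_rpow (by positivity) (by positivity), Real.div_rpow hb ha.le, mul_add,
      mul_one, mul_div_cancel₀ _ (by positivity)]

/-! ### The one-dimensional inequality for sumsets -/

/-- Taking log₂ gives 3k < (k+2) log₂(k+1), the condition 3l < k+2 of `logGap_one_nonpos` for l = k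
/ log₂(k+1). -/
theorem eight_pow_lt {k : ℕ} (hk : 2 ≤ k) : 8 ^ k < (k + 1) ^ (k + 2) := by
  rcases lt_or_ge k 7 with h | h
  · interval_cases k <;> norm_num
  · calc 8 ^ k ≤ (k + 1) ^ k := Nat.pow_le_pow_left (by omega) k
      _ < (k + 1) ^ (k + 2) := Nat.pow_lt_pow_right (by omega) (by omega)

theorem one_add_rpow_le_geom_sum {k : ℕ} (hk : 2 ≤ k) {p : ℝ}
    (hp : p = Real.logb 2 (k + 1)) {t : ℝ} (ht0 : 0 ≤ t) (ht1 : t ≤ 1) :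
    (1 + t ^ (k / p)) ^ p ≤ ∑ j ∈ Finset.range (k + 1), t ^ j := by
  have hk0 : (0 : ℝ) < k := by exact_mod_cast (by omega : 0 < k)
  have hk1 : (0 : ℝ) < k + 1 := by positivity
  have hp0 : 0 < p := by rw [hp]; exact Real.logb_pos one_lt_two (by linarith)
  have h2p : (2 : ℝ) ^ p = k + 1 := by
    rw [hp, Real.rpow_logb two_pos (by norm_num) hk1]
  have hpk : p < k := by
    rw [hp, Real.logb_lt_iff_lt_rpow one_lt_two hk1, Real.rpow_natCast]
    have : k + 1 < 2 ^ k := by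
      clear * - hk
      induction k, hk using Nat.le_induction with
      | base => norm_num
      | succ n hn ih => rw [pow_succ]; omega
    exact_mod_cast this
  have hkp : 3 * k < (k + 2) * p := by
    have h : (8 : ℝ) ^ k < ((k : ℝ) + 1) ^ (k + 2) := by exact_mod_cast eight_pow_lt hk
    have := Real.log_lt_log (by positivity) h
    rw [Real.log_pow, Real.log_pow, show (8 : ℝ) = 2 ^ 3 by norm_num, Real.log_pow] at this
    rw [hp, Real.logb, mul_div_assoc', lt_div_iff₀ (Real.log_pos one_lt_two)]
    push_cast at this
    linarith
  rcases ht0.eq_or_lt with rfl | ht0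
  · rw [Real.zero_rpow (by positivity), add_zero, Real.one_rpow, Finset.sum_range_succ']
    simp
  rcases ht1.eq_or_lt with rfl | ht1
  · simp [one_add_one_eq_two, h2p]
  have hl0 : logGap (fun _ => 1) k p (k / p) 0 = 0 := by
    have : expMoment (fun _ => 1) k 0 0 = k + 1 := by simp [expMoment]
    rw [logGap, this, mul_zero, Real.exp_zero, one_add_one_eq_two, ← h2p, Real.log_rpow two_pos,
      sub_self]
  have := logGap_one_nonpos (k := k) (by omega) (p := p) (l := k / p)
    (mul_div_cancel₀ _ hp0.ne') (by rwa [one_lt_div hp0])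
    (by rw [← mul_div_assoc, div_lt_iff₀ hp0]; exact hkp) hl0 (Real.log_neg ht0 ht1)
  rw [logGap, exp_mul_log ht0, expMoment_zero_log _ _ ht0, sub_nonpos] at this
  simp only [one_mul] at this
  rw [← Real.log_rpow (by positivity)] at this
  refine (Real.log_le_log_iff (by positivity) ?_).1 this
  exact Finset.sum_pos (fun j _ => by positivity) ⟨0, by simp⟩

/-! ### Comparison of truncated geometric series -/

/-- The truncated geometric series `1 + u + ⋯ + u ^ n`. -/
def geomPoly (n : ℕ) (u : ℝ) : ℝ := ∑ j ∈ Finset.range (n + 1), u ^ j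

/-- The derivative of `geomPoly n`. -/
def geomPolyDeriv (n : ℕ) (u : ℝ) : ℝ := ∑ j ∈ Finset.range (n + 1), j * u ^ (j - 1)

theorem hasDerivAt_geomPoly (n : ℕ) (u : ℝ) : HasDerivAt (geomPoly n) (geomPolyDeriv n u) u := by
  unfold geomPoly geomPolyDeriv
  exact HasDerivAt.fun_sum fun j _ => hasDerivAt_pow j u

theorem one_le_geomPoly (n : ℕ) {u : ℝ} (hu : 0 ≤ u) : 1 ≤ geomPoly n u := by
  unfold geomPoly
  rw [Finset.sum_range_succ', pow_zero]
  have : 0 ≤ ∑ j ∈ Finset.range n, u ^ (j + 1) := by positivity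
  linarith

theorem geomPoly_succ (n : ℕ) (u : ℝ) : geomPoly (n + 1) u = geomPoly n u + u ^ (n + 1) :=
  Finset.sum_range_succ _ _

theorem geomPolyDeriv_succ (n : ℕ) (u : ℝ) :
    geomPolyDeriv (n + 1) u = geomPolyDeriv n u + (n + 1) * u ^ n := by
  unfold geomPolyDeriv
  rw [Finset.sum_range_succ]; simp

theorem one_sub_mul_geomPoly (n : ℕ) (u : ℝ) : (1 - u) * geomPoly n u = 1 - u ^ (n + 1) := by
  rw [mul_comm]; exact geom_sum_mul_neg u (n + 1)

theorem one_sub_mul_geomPolyDeriv (n : ℕ) (u : ℝ) :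
    (1 - u) * geomPolyDeriv n u = geomPoly n u - (n + 1) * u ^ n := by
  induction n with
  | zero => simp [geomPoly, geomPolyDeriv]
  | succ n ih => rw [geomPolyDeriv_succ, mul_add, ih, geomPoly_succ]; push_cast; ring

/-- AM-GM on the pairs u^j, u^(n-j). Writing u = s² gives a meaning to the geometric mean u^(n/2)
for odd n. -/
theorem sq_mul_pow_le_geomPoly_sq (n : ℕ) {u : ℝ} (hu : 0 ≤ u) :
    ((n : ℝ) + 1) ^ 2 * u ^ n ≤ geomPoly n u ^ 2 := by
  obtain ⟨s, hs, rfl⟩ : ∃ s : ℝ, 0 ≤ s ∧ u = s ^ 2 :=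
    ⟨√u, Real.sqrt_nonneg u, (Real.sq_sqrt hu).symm⟩
  have h : 2 * (((n : ℝ) + 1) * s ^ n) ≤ 2 * geomPoly n (s ^ 2) := by
    have h1 : 2 * geomPoly n (s ^ 2)
        = ∑ j ∈ Finset.range (n + 1), ((s ^ 2) ^ j + (s ^ 2) ^ (n - j)) := by
      rw [Finset.sum_add_distrib, two_mul]
      congr 1
      unfold geomPoly
      rw [← Finset.sum_range_reflect]
      refine Finset.sum_congr rfl fun j hj => ?_
      rw [Nat.add_sub_cancel]
    have h2 : 2 * (((n : ℝ) + 1) * s ^ n) = ∑ j ∈ Finset.range (n + 1), 2 * s ^ n := by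
      simp; ring
    rw [h1, h2]
    refine Finset.sum_le_sum fun j hj => ?_
    have hj' : j ≤ n := Nat.lt_succ_iff.1 (Finset.mem_range.1 hj)
    have h3 : s ^ n = s ^ j * s ^ (n - j) := by rw [← pow_add]; congr 1; omega
    rw [h3, ← pow_mul, ← pow_mul, mul_comm 2 j, mul_comm 2 (n - j), pow_mul, pow_mul]
    nlinarith [sq_nonneg (s ^ j - s ^ (n - j))]
  have h' : ((n : ℝ) + 1) * s ^ n ≤ geomPoly n (s ^ 2) := by linarith
  calc ((n : ℝ) + 1) ^ 2 * (s ^ 2) ^ n = (((n : ℝ) + 1) * s ^ n) ^ 2 := by ring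
    _ ≤ _ := pow_le_pow_left₀ (by positivity) h' 2

/-- After multiplication by 1 - u, the numerator of the derivative collapses to g_n² - (n+1)² u^n,
where g_n is `geomPoly n u`; this is nonnegative by AM-GM. -/
theorem monotoneOn_log_geomPoly_succ (n : ℕ) :
    MonotoneOn (fun u => (n + 1) * Real.log (geomPoly n u) - n * Real.log (geomPoly (n + 1) u))
      (Set.Icc 0 1) := by
  have hd : ∀ u, 0 ≤ u → HasDerivAt
      (fun u => (n + 1) * Real.log (geomPoly n u) - n * Real.log (geomPoly (n + 1) u))
      ((n + 1) * (geomPolyDeriv n u / geomPoly n u)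
        - n * (geomPolyDeriv (n + 1) u / geomPoly (n + 1) u)) u := by
    intro u hu
    have h1 := one_le_geomPoly n hu
    have h2 := one_le_geomPoly (n + 1) hu
    exact (((hasDerivAt_geomPoly n u).log (by linarith)).const_mul _).sub
      (((hasDerivAt_geomPoly (n + 1) u).log (by linarith)).const_mul _)
  refine monotoneOn_of_deriv_nonneg (convex_Icc 0 1)
    (fun u hu => (hd u hu.1).continuousAt.continuousWithinAt)
    (fun u hu => ?_) (fun u hu => ?_)
  · rw [interior_Icc] at hu
    exact (hd u hu.1.le).differentiableAt.differentiableWithinAt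
  · rw [interior_Icc] at hu
    rw [(hd u hu.1.le).deriv]
    have h1 := one_le_geomPoly n hu.1.le
    have h2 := one_le_geomPoly (n + 1) hu.1.le
    have e1 := one_sub_mul_geomPoly n u
    have e2 := one_sub_mul_geomPolyDeriv n u
    have e3 := sq_mul_pow_le_geomPoly_sq n hu.1.le
    have hu1 : 0 < 1 - u := by linarith [hu.2]
    have key : 0 ≤ (n + 1) * geomPolyDeriv n u * geomPoly (n + 1) u
        - n * geomPolyDeriv (n + 1) u * geomPoly n u := by
      refine nonneg_of_mul_nonneg_right (a := 1 - u) ?_ hu1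
      have : (1 - u) * ((n + 1) * geomPolyDeriv n u * geomPoly (n + 1) u
          - n * geomPolyDeriv (n + 1) u * geomPoly n u)
          = geomPoly n u ^ 2 - ((n : ℝ) + 1) ^ 2 * u ^ n := by
        rw [geomPoly_succ, geomPolyDeriv_succ]
        linear_combination (geomPoly n u + (n + 1) * u ^ (n + 1)) * e2
          - n * (n + 1) * u ^ n * e1 - (n + 1) * u ^ n * e1
      rw [this]; linarith
    have hrw : (n + 1) * (geomPolyDeriv n u / geomPoly n u)
        - n * (geomPolyDeriv (n + 1) u / geomPoly (n + 1) u)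
        = ((n + 1) * geomPolyDeriv n u * geomPoly (n + 1) u
          - n * geomPolyDeriv (n + 1) u * geomPoly n u) / (geomPoly n u * geomPoly (n + 1) u) := by
      have h1' : geomPoly n u ≠ 0 := by linarith
      have h2' : geomPoly (n + 1) u ≠ 0 := by linarith
      field_simp
    rw [hrw]
    exact div_nonneg key (by positivity)

theorem log_geomPoly_sub_le {r k : ℕ} (hrk : r ≤ k) {a b : ℝ} (hb : 0 ≤ b) (hba : b ≤ a)
    (ha : a ≤ 1) :
    k * Real.log (geomPoly r b) - r * Real.log (geomPoly k b)
      ≤ k * Real.log (geomPoly r a) - r * Real.log (geomPoly k a) := by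
  rcases Nat.eq_zero_or_pos r with rfl | hr
  · simp [geomPoly]
  induction k, hrk using Nat.le_induction with
  | base => simp
  | succ n hn ih =>
    have h := monotoneOn_log_geomPoly_succ n ⟨hb, hba.trans ha⟩ ⟨hb.trans hba, ha⟩ hba
    simp only at h
    have hn0 : (0 : ℝ) < n := by exact_mod_cast hr.trans_le hn
    have hr0 : (0 : ℝ) < r := by exact_mod_cast hr
    -- Weights n+1 and r make the log g_n terms cancel, leaving n times the claim for n+1.
    have h1 := mul_le_mul_of_nonneg_left ih (by positivity : (0 : ℝ) ≤ n + 1)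
    have h2 := mul_le_mul_of_nonneg_left h hr0.le
    refine le_of_mul_le_mul_left ?_ hn0
    push_cast
    linarith

/-! ### From equal to unequal weights -/

/-- `1 + u_r (1 + u_{r+1} (⋯ (1 + u_{r+n-1})))`. -/
def nestedSum (u : ℕ → ℝ) : ℕ → ℕ → ℝ
  | 0, _ => 1
  | n + 1, r => 1 + u r * nestedSum u n (r + 1)

theorem nestedSum_eq (u : ℕ → ℝ) (n r : ℕ) :
    nestedSum u n r = ∑ j ∈ Finset.range (n + 1), ∏ i ∈ Finset.range j, u (r + i) := by
  induction n generalizing r with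
  | zero => simp [nestedSum]
  | succ n ih =>
    rw [nestedSum, ih, Finset.sum_range_succ' _ (n + 1), Finset.mul_sum, Finset.prod_range_zero,
      add_comm]
    congr 1
    refine Finset.sum_congr rfl fun j _ => ?_
    rw [Finset.prod_range_succ', add_zero, mul_comm]
    congr 1
    exact Finset.prod_congr rfl fun i _ => by congr 1; omega

theorem one_le_nestedSum {u : ℕ → ℝ} (hu : ∀ i, 0 ≤ u i) (n r : ℕ) : 1 ≤ nestedSum u n r := by
  induction n generalizing r with
  | zero => exact le_rfl
  | succ n ih =>
    rw [nestedSum]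
    have := mul_nonneg (hu r) (zero_le_one.trans (ih (r + 1)))
    linarith

/-- Shows the effect of lowering a block of r equal weights from a to b in front of a fixed tail T.
The sum factors as g_r(x)(1 + (T-1) x^r/g_r(x)); the first factor is handled by
`log_geomPoly_sub_le`, and x^r/g_r(x) increases with x. -/
theorem log_geomPoly_add_mul_sub_le {r k : ℕ} (hrk : r ≤ k) {a b T : ℝ} (hb : 0 ≤ b) (hba : b ≤ a)
    (ha : a ≤ 1) (hT : 1 ≤ T) :
    k * Real.log (∑ j ∈ Finset.range r, b ^ j + b ^ r * T) - r * Real.log (geomPoly k b)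
      ≤ k * Real.log (∑ j ∈ Finset.range r, a ^ j + a ^ r * T)
        - r * Real.log (geomPoly k a) := by
  have ha0 := hb.trans hba
  have hsplit : ∀ x : ℝ, 0 ≤ x → Real.log (∑ j ∈ Finset.range r, x ^ j + x ^ r * T)
      = Real.log (geomPoly r x) + Real.log (1 + (T - 1) * (x ^ r / geomPoly r x)) := by
    intro x hx
    have h1 := one_le_geomPoly r hx
    have h1' : 0 < geomPoly r x := by linarith
    have h2 : 0 ≤ (T - 1) * (x ^ r / geomPoly r x) :=
      mul_nonneg (by linarith) (by positivity)
    rw [← Real.log_mul (by positivity) (by positivity)]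
    congr 1
    rw [mul_add, mul_one, mul_left_comm, mul_div_cancel₀ _ h1'.ne']
    unfold geomPoly
    rw [Finset.sum_range_succ]; ring
  rw [hsplit a ha0, hsplit b hb]
  have h1 := log_geomPoly_sub_le hrk hb hba ha
  have hB := one_le_geomPoly r hb
  have hA := one_le_geomPoly r ha0
  have h2 : b ^ r / geomPoly r b ≤ a ^ r / geomPoly r a := by
    rw [div_le_div_iff₀ (by linarith) (by linarith)]
    unfold geomPoly
    rw [Finset.mul_sum, Finset.mul_sum]
    refine Finset.sum_le_sum fun j hj => ?_
    have hj' : j ≤ r := Nat.lt_succ_iff.1 (Finset.mem_range.1 hj)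
    obtain ⟨m, rfl⟩ := Nat.exists_eq_add_of_le hj'
    have := pow_le_pow_left₀ hb hba m
    have h3 : 0 ≤ b ^ j * a ^ j := by positivity
    calc b ^ (j + m) * a ^ j = (b ^ j * a ^ j) * b ^ m := by ring
      _ ≤ (b ^ j * a ^ j) * a ^ m := mul_le_mul_of_nonneg_left this h3
      _ = _ := by ring
  have h3 : 0 ≤ b ^ r / geomPoly r b := div_nonneg (by positivity) (by linarith)
  have h4 : Real.log (1 + (T - 1) * (b ^ r / geomPoly r b))
      ≤ Real.log (1 + (T - 1) * (a ^ r / geomPoly r a)) := by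
    have h5 := mul_le_mul_of_nonneg_left h2 (by linarith : (0 : ℝ) ≤ T - 1)
    have h6 := mul_nonneg (by linarith : (0 : ℝ) ≤ T - 1) h3
    exact Real.log_le_log (by linarith) (by linarith)
  have := mul_le_mul_of_nonneg_left h4 (Nat.cast_nonneg (α := ℝ) k)
  linarith

/-- The first r weights have been equalised to a. Lowering them to u_r extends the block by one, and
equality holds once the block has length k. The case r = 0 reads ∏ g_k(u_i) ≤ (∑_j ∏_(i<j) u_i)^k.
-/
theorem sum_log_geomPoly_le {u : ℕ → ℝ} (hu : ∀ i, 0 ≤ u i) (hanti : Antitone u) {k : ℕ}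
    (n r : ℕ) (hrn : r + n = k) {a : ℝ} (ha0 : 0 ≤ a) (ha : a ≤ 1) (hua : u r ≤ a) :
    r * Real.log (geomPoly k a) + ∑ i ∈ Finset.range n, Real.log (geomPoly k (u (r + i)))
      ≤ k * Real.log (∑ j ∈ Finset.range r, a ^ j + a ^ r * nestedSum u n r) := by
  induction n generalizing r a with
  | zero =>
    obtain rfl : r = k := hrn
    rw [nestedSum, mul_one, ← Finset.sum_range_succ]
    simp [geomPoly]
  | succ n ih =>
    have h1 := ih (r + 1) (by omega) (hu r) (hua.trans ha) (hanti (Nat.le_succ r))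
    have h2 := log_geomPoly_add_mul_sub_le (k := k) (by omega : r ≤ k) (hu r) hua ha
      (one_le_nestedSum hu (n + 1) r)
    have h3 : ∑ j ∈ Finset.range (r + 1), u r ^ j + u r ^ (r + 1) * nestedSum u n (r + 1)
        = ∑ j ∈ Finset.range r, u r ^ j + u r ^ r * nestedSum u (n + 1) r := by
      rw [Finset.sum_range_succ, nestedSum]; ring
    rw [h3] at h1
    have h4 : ∑ i ∈ Finset.range (n + 1), Real.log (geomPoly k (u (r + i)))
        = ∑ i ∈ Finset.range n, Real.log (geomPoly k (u (r + 1 + i)))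
          + Real.log (geomPoly k (u r)) := by
      rw [Finset.sum_range_succ', add_zero]
      congr 1
      exact Finset.sum_congr rfl fun i _ => by congr 3; omega
    rw [h4]
    push_cast at h1
    linarith

/-- The analytic inequality driving the induction for sumsets in the cube. -/
theorem prod_one_add_rpow_le {k : ℕ} (hk : 2 ≤ k) {t : ℕ → ℝ} (ht : ∀ i, 0 ≤ t i)
    (ht1 : ∀ i, t i ≤ 1) (hanti : Antitone t) {q : ℝ} (hq : q = Real.logb 2 (k + 1) / k) :
    ∏ i ∈ Finset.range k, (1 + t i) ^ q
      ≤ ∑ j ∈ Finset.range (k + 1), ∏ i ∈ Finset.range j, t i ^ q := by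
  have hk0 : (0 : ℝ) < k := by exact_mod_cast (by omega : 0 < k)
  set p := Real.logb 2 (k + 1) with hp
  have hp0 : 0 < p := Real.logb_pos one_lt_two (by linarith)
  have hq0 : 0 < q := by rw [hq]; positivity
  set u : ℕ → ℝ := fun i => t i ^ q with hu
  have hu0 : ∀ i, 0 ≤ u i := fun i => Real.rpow_nonneg (ht i) q
  have hu1 : ∀ i, u i ≤ 1 := fun i => Real.rpow_le_one (ht i) (ht1 i) hq0.le
  have hua : Antitone u := fun i j hij => Real.rpow_le_rpow (ht j) (hanti hij) hq0.le
  have h1 := sum_log_geomPoly_le hu0 hua (k := k) k 0 (zero_add k) zero_le_one le_rfl (hu1 0)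
  simp only [Nat.cast_zero, zero_mul, zero_add, Finset.range_zero, Finset.sum_empty, pow_zero,
    one_mul] at h1
  have h2 : ∀ i, p * Real.log (1 + t i) ≤ Real.log (geomPoly k (u i)) := by
    intro i
    have h := one_add_rpow_le_geom_sum hk hp (hu0 i) (hu1 i)
    have h3 : u i ^ (k / p : ℝ) = t i := by
      rw [hu, ← Real.rpow_mul (ht i), hq, div_mul_div_cancel₀ hk0.ne', div_self hp0.ne',
        Real.rpow_one]
    rw [h3] at h
    have h4 : 0 < 1 + t i := by linarith [ht i]
    rw [← Real.log_rpow h4]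
    exact Real.log_le_log (by positivity) h
  have h3 : p * ∑ i ∈ Finset.range k, Real.log (1 + t i) ≤ k * Real.log (nestedSum u k 0) := by
    rw [Finset.mul_sum]
    exact (Finset.sum_le_sum fun i _ => h2 i).trans h1
  have hpos : ∀ i, 0 < 1 + t i := fun i => by linarith [ht i]
  have hS := one_le_nestedSum hu0 k 0
  have h4 : ∑ j ∈ Finset.range (k + 1), ∏ i ∈ Finset.range j, t i ^ q = nestedSum u k 0 := by
    rw [nestedSum_eq]; simp [hu]
  rw [h4, ← Real.log_le_log_iff (Finset.prod_pos fun i _ => by have := hpos i; positivity)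
    (by linarith), Real.log_prod (fun i _ => by have := hpos i; positivity)]
  have h5 : ∑ i ∈ Finset.range k, Real.log ((1 + t i) ^ q)
      = p * (∑ i ∈ Finset.range k, Real.log (1 + t i)) / k := by
    rw [mul_div_right_comm, ← hq, Finset.mul_sum]
    exact Finset.sum_congr rfl fun i _ => Real.log_rpow (hpos i) q
  rw [h5, div_le_iff₀ hk0]
  linarith

/-! ### Sumsets of several sets in the cube -/

/-- The sumset `A₁ + ⋯ + A_k` of a family of finite sets. -/
def familySumset {G : Type*} [AddCommGroup G] [DecidableEq G] {k : ℕ} (A : Fin k → Finset G) :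
    Finset G :=
  (Fintype.piFinset A).image fun a => ∑ i, a i

theorem mem_familySumset {G : Type*} [AddCommGroup G] [DecidableEq G] {k : ℕ}
    {A : Fin k → Finset G} {x : G} :
    x ∈ familySumset A ↔ ∃ a : Fin k → G, (∀ i, a i ∈ A i) ∧ ∑ i, a i = x := by
  simp [familySumset]

theorem familySumset_comp_perm {G : Type*} [AddCommGroup G] [DecidableEq G] {k : ℕ}
    (A : Fin k → Finset G) (σ : Equiv.Perm (Fin k)) :
    familySumset (A ∘ σ) = familySumset A := by
  ext x
  simp only [mem_familySumset]
  constructor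
  · rintro ⟨a, ha, rfl⟩
    exact ⟨a ∘ σ.symm, fun i => by simpa using ha (σ.symm i), Equiv.sum_comp σ.symm a⟩
  · rintro ⟨a, ha, rfl⟩
    exact ⟨a ∘ σ, fun i => ha (σ i), Equiv.sum_comp σ a⟩

theorem mem_discreteCube {d : ℕ} {x : Fin d → ℤ} :
    x ∈ discreteCube d ↔ ∀ i, x i = 0 ∨ x i = 1 := by
  simp [discreteCube]

theorem cons_mem_discreteCube {d : ℕ} {e : ℤ} {x : Fin d → ℤ} :
    (Fin.cons e x : Fin (d + 1) → ℤ) ∈ discreteCube (d + 1) ↔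
      (e = 0 ∨ e = 1) ∧ x ∈ discreteCube d := by
  simp [mem_discreteCube, Fin.forall_fin_succ]

/-- The slice of a subset of the cube at first coordinate `e`. -/
def cubeSlice {d : ℕ} (e : ℤ) (A : Finset (Fin (d + 1) → ℤ)) : Finset (Fin d → ℤ) :=
  (discreteCube d).filter fun x => (Fin.cons e x : Fin (d + 1) → ℤ) ∈ A

theorem mem_of_mem_cubeSlice {d : ℕ} {e : ℤ} {A : Finset (Fin (d + 1) → ℤ)} {x : Fin d → ℤ}
    (hx : x ∈ cubeSlice e A) : (Fin.cons e x : Fin (d + 1) → ℤ) ∈ A :=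
  (Finset.mem_filter.1 hx).2

theorem cubeSlice_subset {d : ℕ} (e : ℤ) (A : Finset (Fin (d + 1) → ℤ)) :
    cubeSlice e A ⊆ discreteCube d := Finset.filter_subset _ _

theorem card_cubeSlice_add {d : ℕ} {A : Finset (Fin (d + 1) → ℤ)}
    (hA : A ⊆ discreteCube (d + 1)) : (cubeSlice 0 A).card + (cubeSlice 1 A).card = A.card := by
  have hinj : ∀ e : ℤ, Function.Injective (fun x : Fin d → ℤ => (Fin.cons e x : Fin (d + 1) → ℤ)) :=
    fun e => Fin.cons_right_injective (α := fun _ => ℤ) e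
  rw [← Finset.card_image_of_injective (cubeSlice 0 A) (hinj 0),
    ← Finset.card_image_of_injective (cubeSlice 1 A) (hinj 1), ← Finset.card_union_of_disjoint]
  · congr 1
    ext y
    simp only [Finset.mem_union, Finset.mem_image]
    constructor
    · rintro (⟨x, hx, rfl⟩ | ⟨x, hx, rfl⟩) <;> exact mem_of_mem_cubeSlice hx
    · intro hy
      have hc := hA hy
      rw [← Fin.cons_self_tail y, cons_mem_discreteCube] at hc
      rcases hc.1 with h | h
      · refine Or.inl ⟨Fin.tail y, Finset.mem_filter.2 ⟨hc.2, ?_⟩, ?_⟩ <;>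
          rw [← h, Fin.cons_self_tail]
        exact hy
      · refine Or.inr ⟨Fin.tail y, Finset.mem_filter.2 ⟨hc.2, ?_⟩, ?_⟩ <;>
          rw [← h, Fin.cons_self_tail]
        exact hy
  · rw [Finset.disjoint_left]
    intro y hy hy'
    obtain ⟨x, -, rfl⟩ := Finset.mem_image.1 hy
    obtain ⟨x', -, h⟩ := Finset.mem_image.1 hy'
    simpa using congrFun h 0

/-- Sets whose points lie in enough slices of `X` have total size at most that of `X`. -/
theorem sum_card_le_of_mem_slices {d k : ℕ} (X : Finset (Fin (d + 1) → ℤ))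
    (T : ℕ → Finset (Fin d → ℤ))
    (h : ∀ m ≤ k, ∀ x ∈ T m, ∃ s : ℤ, ∀ r : ℕ, r ≤ m →
      (Fin.cons (s + r) x : Fin (d + 1) → ℤ) ∈ X) :
    ∑ j ∈ Finset.range (k + 1), (T j).card ≤ X.card := by
  classical
  set tl : (Fin (d + 1) → ℤ) → (Fin d → ℤ) := fun y j => y j.succ with htl
  set U := (Finset.range (k + 1)).biUnion T with hU
  have h1 : ∀ j ∈ Finset.range (k + 1), (T j).card = ∑ x ∈ U, if x ∈ T j then 1 else 0 := by
    intro j hj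
    rw [← Finset.card_filter]
    congr 1
    ext x
    simp only [Finset.mem_filter]
    exact ⟨fun hx => ⟨Finset.mem_biUnion.2 ⟨j, hj, hx⟩, hx⟩, fun hx => hx.2⟩
  rw [Finset.sum_congr rfl h1, Finset.sum_comm]
  calc ∑ x ∈ U, ∑ j ∈ Finset.range (k + 1), (if x ∈ T j then 1 else 0)
      ≤ ∑ x ∈ U, (X.filter fun y => tl y = x).card := by
        refine Finset.sum_le_sum fun x _ => ?_
        rw [← Finset.card_filter]
        set J := (Finset.range (k + 1)).filter fun j => x ∈ T j with hJ
        rcases J.eq_empty_or_nonempty with hemp | hne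
        · simp [hemp]
        -- Only the largest index m in J matters: it puts m+1 ≥ |J| points of X above x.
        have hm := Finset.mem_filter.1 (J.max'_mem hne)
        obtain ⟨s, hs⟩ := h _ (Nat.lt_succ_iff.1 (Finset.mem_range.1 hm.1)) x hm.2
        refine Finset.card_le_card_of_injOn
          (fun j : ℕ => (Fin.cons (s + j) x : Fin (d + 1) → ℤ)) ?_ ?_
        · intro j hj
          exact Finset.mem_coe.2 (Finset.mem_filter.2 ⟨hs j (J.le_max' j hj), rfl⟩)
        · intro i _ j _ hij
          have := congrFun hij 0
          simpa using this
    _ = (X.filter fun y => tl y ∈ U).card :=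
        Finset.sum_card_fiberwise_eq_card_filter X U tl
    _ ≤ X.card := Finset.card_filter_le _ _

/-- A summand from an intersection can be lifted with first coordinate 0 or 1 at will. Lifting
exactly the first r of the m such summands with 1 shifts the total by r; the other summands keep a
fixed lift. -/
theorem familySumset_slices {d k : ℕ} (A : Fin k → Finset (Fin (d + 1) → ℤ)) {m : ℕ} (hm : m ≤ k)
    {x : Fin d → ℤ}
    (hx : x ∈ familySumset fun i : Fin k => if (i : ℕ) < m
      then cubeSlice 0 (A i) ∩ cubeSlice 1 (A i) else cubeSlice 0 (A i) ∪ cubeSlice 1 (A i)) :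
    ∃ s : ℤ, ∀ r : ℕ, r ≤ m → (Fin.cons (s + r) x : Fin (d + 1) → ℤ) ∈ familySumset A := by
  obtain ⟨a, ha, rfl⟩ := mem_familySumset.1 hx
  have hb : ∀ i : Fin k, ∃ e : ℤ, m ≤ (i : ℕ) → (Fin.cons e (a i) : Fin (d + 1) → ℤ) ∈ A i := by
    intro i
    by_cases hi : (i : ℕ) < m
    · exact ⟨0, fun h => absurd h (not_le.2 hi)⟩
    · have := ha i
      rw [if_neg hi, Finset.mem_union] at this
      rcases this with h | h
      · exact ⟨0, fun _ => mem_of_mem_cubeSlice h⟩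
      · exact ⟨1, fun _ => mem_of_mem_cubeSlice h⟩
  choose e he using hb
  refine ⟨∑ i : Fin k, if (i : ℕ) < m then 0 else e i, fun r hr => ?_⟩
  set b : Fin k → ℤ := fun i =>
    if (i : ℕ) < m then (if (i : ℕ) < r then 1 else 0) else e i with hbdef
  refine mem_familySumset.2 ⟨fun i => Fin.cons (b i) (a i), fun i => ?_, ?_⟩
  · change (Fin.cons (b i) (a i) : Fin (d + 1) → ℤ) ∈ A i
    by_cases hi : (i : ℕ) < m
    · have := ha i
      rw [if_pos hi, Finset.mem_inter] at this
      by_cases hir : (i : ℕ) < r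
      · have hbi : b i = 1 := by simp [hbdef, hi, hir]
        rw [hbi]; exact mem_of_mem_cubeSlice this.2
      · have hbi : b i = 0 := by simp [hbdef, hi, hir]
        rw [hbi]; exact mem_of_mem_cubeSlice this.1
    · have hbi : b i = e i := by simp [hbdef, hi]
      rw [hbi]; exact he i (not_lt.1 hi)
  · have hsum : ∑ i, b i = (∑ i : Fin k, if (i : ℕ) < m then 0 else e i) + r := by
      have hr' : ((r : ℕ) : ℤ) = ∑ i : Fin k, if (i : ℕ) < r then 1 else 0 := by
        rw [Fin.sum_univ_eq_sum_range (fun i => if i < r then (1 : ℤ) else 0), ← Finset.sum_filter,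
          Finset.sum_const, nsmul_eq_mul, mul_one]
        have : (Finset.range k).filter (fun i => i < r) = Finset.range r := by
          ext i; simp only [Finset.mem_filter, Finset.mem_range]; omega
        rw [this, Finset.card_range]
      rw [hr', ← Finset.sum_add_distrib]
      refine Finset.sum_congr rfl fun i _ => ?_
      by_cases hi : (i : ℕ) < m
      · simp [hbdef, hi]
      · have : ¬ (i : ℕ) < r := by omega
        simp [hbdef, hi, this]
    funext j
    rw [Finset.sum_apply]
    refine Fin.cases ?_ (fun j => ?_) j
    · simpa using hsum
    · simp

/-- Since |A_i| = |C_i|(1 + t_i) with t_i = |D_i|/|C_i|, `prod_one_add_rpow_le` splits the product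
into k+1 terms. The m-th is the induction hypothesis for m intersections and k - m unions. -/
theorem prod_card_rpow_le_of_antitone {d k : ℕ} (hk : 2 ≤ k) {q : ℝ}
    (hq : q = Real.logb 2 (k + 1) / k) (A : Fin k → Finset (Fin (d + 1) → ℤ))
    (hA : ∀ i, A i ⊆ discreteCube (d + 1)) (hne : ∀ i, (A i).Nonempty)
    (hanti : Antitone fun i => ((cubeSlice 0 (A i) ∩ cubeSlice 1 (A i)).card : ℝ)
      / (cubeSlice 0 (A i) ∪ cubeSlice 1 (A i)).card)
    (ih : ∀ B : Fin k → Finset (Fin d → ℤ), (∀ i, B i ⊆ discreteCube d) →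
      ∏ i, ((B i).card : ℝ) ^ q ≤ (familySumset B).card) :
    ∏ i, ((A i).card : ℝ) ^ q ≤ (familySumset A).card := by
  set C := fun i => cubeSlice 0 (A i) ∪ cubeSlice 1 (A i) with hC
  set D := fun i => cubeSlice 0 (A i) ∩ cubeSlice 1 (A i) with hD
  have hDC : ∀ i, (D i).card ≤ (C i).card := fun i =>
    Finset.card_le_card (Finset.inter_subset_left.trans Finset.subset_union_left)
  have hCD : ∀ i, (C i).card + (D i).card = (A i).card := fun i => by
    rw [← card_cubeSlice_add (hA i)]; exact Finset.card_union_add_card_inter _ _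
  have hCpos : ∀ i, (0 : ℝ) < (C i).card := fun i => by
    have := (hne i).card_pos
    have h1 := hDC i
    have h2 := hCD i
    exact_mod_cast (by omega : 0 < (C i).card)
  -- The value 0 beyond k keeps the sequence antitone on all of ℕ.
  set t : ℕ → ℝ := fun n => if h : n < k then ((D ⟨n, h⟩).card : ℝ) / (C ⟨n, h⟩).card else 0
    with ht
  have htfin : ∀ i : Fin k, t i = ((D i).card : ℝ) / (C i).card := fun i => by simp [ht]
  have ht0 : ∀ n, 0 ≤ t n := by
    intro n; simp only [ht]; split_ifs <;> positivity
  have ht1 : ∀ n, t n ≤ 1 := by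
    intro n; simp only [ht]; split_ifs with h
    · rw [div_le_one (hCpos _)]; exact_mod_cast hDC _
    · exact zero_le_one
  have htanti : Antitone t := by
    intro m n hmn
    by_cases hn : n < k
    · simp only [ht, hn, hmn.trans_lt hn, dif_pos]
      exact hanti (show (⟨m, hmn.trans_lt hn⟩ : Fin k) ≤ ⟨n, hn⟩ from hmn)
    · have : t n = 0 := by simp [ht, hn]
      rw [this]; exact ht0 m
  have hM := prod_one_add_rpow_le hk ht0 ht1 htanti hq
  have hcount := sum_card_le_of_mem_slices (k := k) (familySumset A)
    (fun m => familySumset fun i : Fin k => if (i : ℕ) < m then D i else C i)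
    (fun m hm x hx => familySumset_slices A hm hx)
  have hcount' : ∑ m ∈ Finset.range (k + 1),
      ((familySumset fun i : Fin k => if (i : ℕ) < m then D i else C i).card : ℝ)
      ≤ (familySumset A).card := by exact_mod_cast hcount
  refine le_trans ?_ hcount'
  have hAi : ∀ i : Fin k, ((A i).card : ℝ) ^ q = ((C i).card : ℝ) ^ q * (1 + t i) ^ q := by
    intro i
    rw [← Real.mul_rpow (hCpos i).le (by linarith [ht0 i]), htfin, mul_add, mul_one,
      mul_div_cancel₀ _ (hCpos i).ne', ← hCD i]
    push_cast; rfl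
  rw [Finset.prod_congr rfl fun i _ => hAi i, Finset.prod_mul_distrib,
    Fin.prod_univ_eq_prod_range (fun n => (1 + t n) ^ q) k]
  refine (mul_le_mul_of_nonneg_left hM
    (Finset.prod_nonneg fun i _ => (Real.rpow_pos_of_pos (hCpos i) q).le)).trans ?_
  rw [Finset.mul_sum]
  refine Finset.sum_le_sum fun m hm => ?_
  have hm' : m ≤ k := Nat.lt_succ_iff.1 (Finset.mem_range.1 hm)
  refine le_trans (le_of_eq ?_) (ih (fun i : Fin k => if (i : ℕ) < m then D i else C i) ?_)
  · have h1 : ∏ i ∈ Finset.range m, t i ^ q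
        = ∏ i : Fin k, if (i : ℕ) < m then t i ^ q else 1 := by
      rw [Fin.prod_univ_eq_prod_range (fun n => if n < m then t n ^ q else 1) k,
        ← Finset.prod_filter]
      congr 1
      ext i; simp only [Finset.mem_filter, Finset.mem_range]; omega
    rw [h1, ← Finset.prod_mul_distrib]
    refine Finset.prod_congr rfl fun i _ => ?_
    by_cases hi : (i : ℕ) < m
    · simp only [hi, if_true]
      rw [htfin, ← Real.mul_rpow (hCpos i).le (htfin i ▸ ht0 i), mul_div_cancel₀ _ (hCpos i).ne']
    · simp only [hi, if_false, mul_one]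
  · intro i
    have h1 := Finset.union_subset (cubeSlice_subset 0 (A i)) (cubeSlice_subset 1 (A i))
    split_ifs
    · exact Finset.inter_subset_left.trans (cubeSlice_subset 0 (A i))
    · exact h1

/-- A lower bound for the sumset of `k` subsets of the discrete cube. -/
theorem prod_card_rpow_le_card_familySumset {k : ℕ} (hk : 2 ≤ k) {q : ℝ}
    (hq : q = Real.logb 2 (k + 1) / k) (d : ℕ) (A : Fin k → Finset (Fin d → ℤ))
    (hA : ∀ i, A i ⊆ discreteCube d) :
    ∏ i, ((A i).card : ℝ) ^ q ≤ (familySumset A).card := by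
  have hk0 : (0 : ℝ) < k := by exact_mod_cast (by omega : 0 < k)
  have hq0 : 0 < q := by
    rw [hq]; exact div_pos (Real.logb_pos one_lt_two (by linarith)) hk0
  induction d with
  | zero =>
    by_cases hne : ∀ i, (A i).Nonempty
    · have h1 : (1 : ℝ) ≤ (familySumset A).card := by
        choose a ha using hne
        have : (familySumset A).Nonempty := ⟨_, mem_familySumset.2 ⟨a, ha, rfl⟩⟩
        exact_mod_cast this.card_pos
      refine le_trans (Finset.prod_le_one (fun i _ => by positivity) fun i _ => ?_) h1
      have : (A i).card ≤ 1 := Finset.card_le_one_of_subsingleton _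
      exact Real.rpow_le_one (by positivity) (by exact_mod_cast this) hq0.le
    · push Not at hne
      obtain ⟨i, hi⟩ := hne
      rw [Finset.prod_eq_zero (Finset.mem_univ i)
        (by rw [hi, Finset.card_empty, Nat.cast_zero, Real.zero_rpow hq0.ne'])]
      positivity
  | succ d ih =>
    by_cases hne : ∀ i, (A i).Nonempty
    · set f : Fin k → ℝ := fun i => ((cubeSlice 0 (A i) ∩ cubeSlice 1 (A i)).card : ℝ)
        / (cubeSlice 0 (A i) ∪ cubeSlice 1 (A i)).card with hf
      -- The sumset and the product do not depend on the order of the sets, so the ratios may be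
      -- sorted decreasingly.
      set σ := Tuple.sort fun i => - f i with hσ
      have hmono : Monotone ((fun i => - f i) ∘ σ) := Tuple.monotone_sort _
      have := prod_card_rpow_le_of_antitone hk hq (A ∘ σ) (fun i => hA (σ i))
        (fun i => hne (σ i)) (fun i j hij => by
          have := hmono hij
          simp only [Function.comp_apply, neg_le_neg_iff] at this
          exact this) ih
      rw [familySumset_comp_perm] at this
      refine le_trans (le_of_eq ?_) this
      exact (Equiv.prod_comp σ fun i => ((A i).card : ℝ) ^ q).symm
    · push Not at hne
      obtain ⟨i, hi⟩ := hne
      rw [Finset.prod_eq_zero (Finset.mem_univ i)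
        (by rw [hi, Finset.card_empty, Nat.cast_zero, Real.zero_rpow hq0.ne'])]
      positivity

theorem card_rpow_le_card_iteratedSumset {k : ℕ} (hk : 2 ≤ k) {d : ℕ} {A : Finset (Fin d → ℤ)}
    (hA : A ⊆ discreteCube d) :
    (A.card : ℝ) ^ Real.logb 2 (k + 1) ≤ (iteratedSumset k A).card := by
  have h := prod_card_rpow_le_card_familySumset hk rfl d (fun _ => A) (fun _ => hA)
  have hk0 : (k : ℝ) ≠ 0 := by exact_mod_cast (by omega : k ≠ 0)
  rw [Finset.prod_const, Finset.card_univ, Fintype.card_fin, ← Real.rpow_natCast,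
    ← Real.rpow_mul (by positivity), div_mul_cancel₀ _ hk0] at h
  exact h

/-! ### Roots of unity and Parseval -/

/-- Points `z i` of the unit circle on which the monomials of degree at most `k` are orthogonal. -/
def IsOrthogonalSystem {ι : Type*} [Fintype ι] (k : ℕ) (z : ι → ℂ) : Prop :=
  ∀ a b : ℕ, a ≤ k → b ≤ k →
    ∑ i, z i ^ a * (starRingEnd ℂ) (z i ^ b) = if a = b then (Fintype.card ι : ℂ) else 0

/-- The (k+1)-th roots of unity: two exponents up to k differ by less than k+1, so distinct
monomials sum to zero against each other. -/
theorem exists_isOrthogonalSystem (k : ℕ) : ∃ z : Fin (k + 1) → ℂ, IsOrthogonalSystem k z := by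
  set ζ : ℂ := Complex.exp (2 * Real.pi * Complex.I / ((k + 1 : ℕ) : ℂ)) with hζ
  have hprim : IsPrimitiveRoot ζ (k + 1) := Complex.isPrimitiveRoot_exp (k + 1) (by omega)
  have hnorm : ‖ζ‖ = 1 := hprim.norm'_eq_one (by omega)
  have hconj : ζ * (starRingEnd ℂ) ζ = 1 := by
    rw [Complex.mul_conj, Complex.normSq_eq_norm_sq, hnorm]; simp
  have hpow : ∀ n : ℕ, ζ ^ n * (starRingEnd ℂ) ζ ^ n = 1 := fun n => by
    rw [← mul_pow, hconj, one_pow]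
  have hlt : ∀ a b : ℕ, a < b → b ≤ k → ∑ i : Fin (k + 1), (ζ ^ (i : ℕ)) ^ (b - a) = 0 := by
    intro a b hab hb
    have h1 : ζ ^ (b - a) ≠ 1 := fun h => by
      have := Nat.le_of_dvd (by omega) (hprim.dvd_of_pow_eq_one _ h)
      omega
    have h2 : (ζ ^ (b - a)) ^ (k + 1) = 1 := by
      rw [← pow_mul, mul_comm, pow_mul, hprim.pow_eq_one, one_pow]
    rw [Fin.sum_univ_eq_sum_range (fun i => (ζ ^ i) ^ (b - a)) (k + 1)]
    have h3 := geom_sum_mul (ζ ^ (b - a)) (k + 1)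
    rw [h2, sub_self] at h3
    rw [← (mul_eq_zero.1 h3).resolve_right (sub_ne_zero.2 h1)]
    exact Finset.sum_congr rfl fun i _ => by rw [← pow_mul, ← pow_mul, mul_comm]
  refine ⟨fun i => ζ ^ (i : ℕ), fun a b ha hb => ?_⟩
  rcases lt_trichotomy a b with hab | rfl | hab
  · rw [if_neg hab.ne]
    have h := congrArg (starRingEnd ℂ) (hlt a b hab hb)
    rw [map_sum, map_zero] at h
    rw [← h]
    refine Finset.sum_congr rfl fun i _ => ?_
    obtain ⟨c, rfl⟩ := Nat.exists_eq_add_of_le hab.le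
    have := hpow (i * a)
    rw [Nat.add_sub_cancel_left]
    simp only [map_pow]
    simp only [← pow_mul, pow_add]
    rw [← mul_assoc, this, one_mul]
  · rw [if_pos rfl]
    simp only [map_pow, ← pow_mul, hpow]
    simp
  · rw [if_neg hab.ne', ← hlt b a hab ha]
    refine Finset.sum_congr rfl fun i _ => ?_
    obtain ⟨c, rfl⟩ := Nat.exists_eq_add_of_le hab.le
    have := hpow (i * b)
    rw [Nat.add_sub_cancel_left]
    simp only [map_pow]
    simp only [← pow_mul, pow_add]
    rw [mul_right_comm, this, one_mul]

theorem ofReal_norm_sq (w : ℂ) : ((‖w‖ ^ 2 : ℝ) : ℂ) = w * (starRingEnd ℂ) w := by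
  rw [Complex.mul_conj, Complex.normSq_eq_norm_sq]

theorem sum_norm_sq_eq {ι : Type*} [Fintype ι] {k : ℕ} {z : ι → ℂ} (hz : IsOrthogonalSystem k z)
    (c : ℕ → ℂ) : ∑ i, ‖∑ j ∈ Finset.range (k + 1), c j * z i ^ j‖ ^ 2
      = Fintype.card ι * ∑ j ∈ Finset.range (k + 1), ‖c j‖ ^ 2 := by
  have : ((∑ i, ‖∑ j ∈ Finset.range (k + 1), c j * z i ^ j‖ ^ 2 : ℝ) : ℂ)
      = ((Fintype.card ι * ∑ j ∈ Finset.range (k + 1), ‖c j‖ ^ 2 : ℝ) : ℂ) := by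
    rw [Complex.ofReal_sum, Complex.ofReal_mul, Complex.ofReal_sum]
    simp only [ofReal_norm_sq, map_sum, Finset.sum_mul_sum]
    rw [Finset.sum_comm, Finset.mul_sum]
    refine Finset.sum_congr rfl fun a ha => ?_
    rw [Finset.sum_comm]
    have h1 : ∀ b ∈ Finset.range (k + 1),
        ∑ i, c a * z i ^ a * (starRingEnd ℂ) (c b * z i ^ b)
          = if a = b then Fintype.card ι * (c a * (starRingEnd ℂ) (c a)) else 0 := by
      intro b hb
      have h2 := hz a b (Nat.lt_succ_iff.1 (Finset.mem_range.1 ha))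
        (Nat.lt_succ_iff.1 (Finset.mem_range.1 hb))
      have h3 : ∑ i, c a * z i ^ a * (starRingEnd ℂ) (c b * z i ^ b)
          = c a * (starRingEnd ℂ) (c b) * ∑ i, z i ^ a * (starRingEnd ℂ) (z i ^ b) := by
        rw [Finset.mul_sum]
        refine Finset.sum_congr rfl fun i _ => ?_
        rw [map_mul]; ring
      rw [h3, h2]
      split_ifs with h
      · subst h; ring
      · simp
    rw [Finset.sum_congr rfl h1, Finset.sum_ite_eq, if_pos ha]
    simp
  exact_mod_cast this

/-- Parseval applied to the binomial expansion of (F + Gz)^k; this is the source of the squared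
binomials in the two-point inequality. -/
theorem sum_norm_add_mul_pow {ι : Type*} [Fintype ι] {k : ℕ} {z : ι → ℂ}
    (hz : IsOrthogonalSystem k z) (F G : ℂ) :
    ∑ i, (‖F + G * z i‖ ^ 2) ^ k = Fintype.card ι * ∑ j ∈ Finset.range (k + 1),
      (k.choose j : ℝ) ^ 2 * ((‖F‖ ^ 2) ^ (k - j) * (‖G‖ ^ 2) ^ j) := by
  have h := sum_norm_sq_eq hz (fun j => (k.choose j : ℂ) * F ^ (k - j) * G ^ j)
  convert h using 2
  · rw [← pow_mul, mul_comm 2 k, pow_mul, ← norm_pow, add_comm F, add_pow]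
    congr 2
    refine Finset.sum_congr rfl fun j _ => ?_
    rw [mul_pow]; ring
  · refine Finset.sum_congr rfl fun j _ => ?_
    simp only [norm_mul, norm_pow, Complex.norm_natCast]
    ring

/-- The monomial `∏ z_{ω i} ^ {n i}`. -/
def torusMonomial {ι : Type*} {d : ℕ} (z : ι → ℂ) (ω : Fin d → ι) (n : Fin d → ℕ) : ℂ :=
  ∏ i, z (ω i) ^ n i

theorem sum_torusMonomial_mul_conj {ι : Type*} [Fintype ι] {k d : ℕ} {z : ι → ℂ}
    (hz : IsOrthogonalSystem k z) {m n : Fin d → ℕ} (hm : ∀ i, m i ≤ k) (hn : ∀ i, n i ≤ k) :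
    ∑ ω : Fin d → ι, torusMonomial z ω m * (starRingEnd ℂ) (torusMonomial z ω n)
      = if m = n then (Fintype.card ι : ℂ) ^ d else 0 := by
  classical
  have h : ∏ i : Fin d, ∑ e : ι, z e ^ m i * (starRingEnd ℂ) (z e ^ n i)
      = ∑ ω : Fin d → ι, torusMonomial z ω m * (starRingEnd ℂ) (torusMonomial z ω n) := by
    rw [Finset.prod_univ_sum, Fintype.piFinset_univ]
    refine Finset.sum_congr rfl fun ω _ => ?_
    unfold torusMonomial
    rw [map_prod, ← Finset.prod_mul_distrib]
  rw [← h, Finset.prod_congr rfl fun i _ => hz (m i) (n i) (hm i) (hn i)]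
  split_ifs with hmn
  · subst hmn; simp
  · obtain ⟨i, hi⟩ := Function.ne_iff.1 hmn
    exact Finset.prod_eq_zero (Finset.mem_univ i) (if_neg hi)

theorem sum_norm_sum_torusMonomial_sq {ι σ : Type*} [Fintype ι] {k d : ℕ} {z : ι → ℂ}
    (hz : IsOrthogonalSystem k z) (S : Finset σ) (n : σ → Fin d → ℕ)
    (hn : ∀ s ∈ S, ∀ i, n s i ≤ k) :
    ∑ ω : Fin d → ι, ‖∑ s ∈ S, torusMonomial z ω (n s)‖ ^ 2
      = (Fintype.card ι : ℝ) ^ d * ((S ×ˢ S).filter fun x => n x.1 = n x.2).card := by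
  have : ((∑ ω : Fin d → ι, ‖∑ s ∈ S, torusMonomial z ω (n s)‖ ^ 2 : ℝ) : ℂ)
      = (((Fintype.card ι : ℝ) ^ d * ((S ×ˢ S).filter fun x => n x.1 = n x.2).card : ℝ) : ℂ) := by
    rw [Complex.ofReal_sum]
    simp only [ofReal_norm_sq, map_sum, Finset.sum_mul_sum]
    have h1 : ∀ ω : Fin d → ι, ∑ s ∈ S, ∑ t ∈ S,
        torusMonomial z ω (n s) * (starRingEnd ℂ) (torusMonomial z ω (n t))
        = ∑ x ∈ S ×ˢ S, torusMonomial z ω (n x.1) * (starRingEnd ℂ) (torusMonomial z ω (n x.2)) :=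
      fun ω => by rw [Finset.sum_product]
    rw [Finset.sum_congr rfl fun ω _ => h1 ω, Finset.sum_comm,
      Finset.sum_congr rfl fun x hx => sum_torusMonomial_mul_conj hz
        (hn x.1 (Finset.mem_product.1 hx).1) (hn x.2 (Finset.mem_product.1 hx).2),
      ← Finset.sum_filter, Finset.sum_const, nsmul_eq_mul]
    push_cast; ring
  exact_mod_cast this

/-- The `k`-additive energy of a subset of the cube as a moment of its exponential sum. -/
theorem sum_norm_pow_eq_kAdditiveEnergy {ι : Type*} [Fintype ι] {k d : ℕ} {z : ι → ℂ}
    (hz : IsOrthogonalSystem k z) {A : Finset (Fin d → ℤ)} (hA : A ⊆ discreteCube d) :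
    ∑ ω : Fin d → ι, (‖∑ a ∈ A, torusMonomial z ω fun i => (a i).toNat‖ ^ 2) ^ k
      = (Fintype.card ι : ℝ) ^ d * kAdditiveEnergy k A := by
  have hcube : ∀ a ∈ Fintype.piFinset (fun _ : Fin k => A), ∀ j i,
      (0 ≤ a j i ∧ (a j i).toNat ≤ 1) := by
    intro a ha j i
    rcases mem_discreteCube.1 (hA (Fintype.mem_piFinset.1 ha j)) i with h | h <;> simp [h]
  -- The k-th power of the exponential sum runs over k-tuples. Coordinates of a sum of k vertices
  -- lie in [0, k], within the range of orthogonality, so the finite torus detects equality of sums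
  -- exactly.
  have h := sum_norm_sum_torusMonomial_sq hz (Fintype.piFinset fun _ : Fin k => A)
    (fun a i => ∑ j, (a j i).toNat) (fun a ha i => by
      calc ∑ j, (a j i).toNat ≤ ∑ j : Fin k, 1 := Finset.sum_le_sum fun j _ => (hcube a ha j i).2
        _ = k := by simp)
  have hE : ((Fintype.piFinset fun _ : Fin k => A) ×ˢ (Fintype.piFinset fun _ : Fin k => A)).filter
      (fun x => (fun i => ∑ j, (x.1 j i).toNat) = fun i => ∑ j, (x.2 j i).toNat)
      = ((Fintype.piFinset fun _ : Fin k => A) ×ˢ (Fintype.piFinset fun _ : Fin k => A)).filter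
        fun x => ∑ i, x.1 i = ∑ i, x.2 i := by
    refine Finset.filter_congr fun x hx => ?_
    have key : ∀ a ∈ Fintype.piFinset (fun _ : Fin k => A), ∀ i,
        ((∑ j, (a j i).toNat : ℕ) : ℤ) = (∑ j, a j) i := by
      intro a ha i
      rw [Finset.sum_apply]; push_cast
      exact Finset.sum_congr rfl fun j _ => Int.toNat_of_nonneg (hcube a ha j i).1
    have k1 := key x.1 (Finset.mem_product.1 hx).1
    have k2 := key x.2 (Finset.mem_product.1 hx).2
    constructor
    · intro h
      funext i
      rw [← k1, ← k2]; exact congrArg _ (congrFun h i)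
    · intro h
      funext i
      have := congrFun h i
      rw [← k1, ← k2] at this
      exact_mod_cast this
  rw [hE] at h
  rw [kAdditiveEnergy, ← h]
  refine Finset.sum_congr rfl fun ω _ => ?_
  rw [← pow_mul, mul_comm 2 k, pow_mul, ← norm_pow, Finset.sum_pow']
  congr 2
  refine Finset.sum_congr rfl fun a _ => ?_
  unfold torusMonomial
  rw [Finset.prod_comm]
  exact Finset.prod_congr rfl fun i _ => Finset.prod_pow_eq_pow_sum _ _ _

/-- The exponential sum of the cube factors as ∏ (1 + z_i), so its moment is a product of
one-dimensional ones, each giving ∑ C(k,j)² = C(2k,k). -/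
theorem kAdditiveEnergy_discreteCube (k d : ℕ) :
    kAdditiveEnergy k (discreteCube d) = ((2 * k).choose k) ^ d := by
  obtain ⟨z, hz⟩ := exists_isOrthogonalSystem k
  have h := sum_norm_pow_eq_kAdditiveEnergy hz (Finset.Subset.refl (discreteCube d))
  have h1 : ∀ ω : Fin d → Fin (k + 1),
      (‖∑ a ∈ discreteCube d, torusMonomial z ω fun i => (a i).toNat‖ ^ 2) ^ k
        = ∏ i, (‖1 + 1 * z (ω i)‖ ^ 2) ^ k := by
    intro ω
    have : ∑ a ∈ discreteCube d, torusMonomial z ω (fun i => (a i).toNat)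
        = ∏ i, (1 + 1 * z (ω i)) := by
      unfold torusMonomial discreteCube
      rw [← Finset.prod_univ_sum (fun _ => {0, 1}) (fun i (e : ℤ) => z (ω i) ^ e.toNat)]
      refine Finset.prod_congr rfl fun i _ => ?_
      rw [Finset.sum_pair (by norm_num)]
      simp
    rw [this, norm_prod, Finset.prod_pow, Finset.prod_pow]
  rw [Finset.sum_congr rfl fun ω _ => h1 ω] at h
  have h2 := Finset.prod_univ_sum (fun _ : Fin d => (Finset.univ : Finset (Fin (k + 1))))
    (fun _ e => (‖1 + 1 * z e‖ ^ 2) ^ k)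
  rw [Fintype.piFinset_univ] at h2
  rw [← h2, Finset.prod_const, sum_norm_add_mul_pow hz] at h
  simp only [norm_one, one_pow, mul_one, sum_choose_sq, Finset.card_univ, Fintype.card_fin,
    mul_pow] at h
  have h3 := mul_left_cancel₀ (by positivity) h
  exact_mod_cast h3.symm

/-! ### The upper bound for the energy -/

/-- Hölder with exponents k/(k-j) and k/j; the endpoints j = 0 and j = k, where an exponent would be
infinite, are the hypotheses themselves. -/
theorem sum_pow_mul_pow_le {σ : Type*} (s : Finset σ) {f g : σ → ℝ} (hf : ∀ i, 0 ≤ f i)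
    (hg : ∀ i, 0 ≤ g i) {k j : ℕ} (hj : j ≤ k) {M a b : ℝ} (hM : 0 ≤ M) (ha : 0 ≤ a) (hb : 0 ≤ b)
    (hfa : ∑ i ∈ s, f i ^ k ≤ M * a ^ k) (hgb : ∑ i ∈ s, g i ^ k ≤ M * b ^ k) :
    ∑ i ∈ s, f i ^ (k - j) * g i ^ j ≤ M * (a ^ (k - j) * b ^ j) := by
  rcases Nat.eq_zero_or_pos j with rfl | hj0
  · simpa using hfa
  rcases hj.eq_or_lt with rfl | hjk
  · simpa using hgb
  obtain ⟨m, rfl⟩ := Nat.exists_eq_add_of_lt hjk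
  obtain ⟨n, hn⟩ : ∃ n, n = m + 1 := ⟨_, rfl⟩
  have hjn : j + m + 1 = n + j := by omega
  rw [hjn] at hfa hgb ⊢
  rw [Nat.add_sub_cancel]
  have hj' : (0 : ℝ) < j := by exact_mod_cast hj0
  have hn' : (0 : ℝ) < n := by rw [hn]; positivity
  have hk' : (0 : ℝ) < n + j := by positivity
  have hconj : (((n : ℝ) + j) / n).HolderConjugate (((n : ℝ) + j) / j) := by
    rw [Real.holderConjugate_iff]
    refine ⟨by rw [one_lt_div hn']; linarith, ?_⟩
    field_simp
  have h := Real.inner_le_Lp_mul_Lq_of_nonneg s hconj (f := fun i => f i ^ n)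
    (g := fun i => g i ^ j) (fun i _ => pow_nonneg (hf i) n) (fun i _ => pow_nonneg (hg i) j)
  have e : ∀ (m : ℕ) (x : ℝ), 0 < (m : ℝ) → 0 ≤ x →
      (x ^ m) ^ (((n : ℝ) + j) / m) = x ^ (n + j) := by
    intro m x hm hx
    rw [← Real.rpow_natCast x m, ← Real.rpow_mul hx, mul_div_cancel₀ _ hm.ne',
      ← Real.rpow_natCast x (n + j), Nat.cast_add]
  have e' : ∀ (m : ℕ) (x : ℝ), 0 < (m : ℝ) → 0 ≤ x →
      (x ^ (n + j)) ^ (1 / (((n : ℝ) + j) / m)) = x ^ m := by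
    intro m x hm hx
    rw [← e m x hm hx, ← Real.rpow_mul (by positivity), mul_one_div_cancel (by positivity),
      Real.rpow_one]
  rw [Finset.sum_congr rfl fun i _ => e n (f i) hn' (hf i),
    Finset.sum_congr rfl fun i _ => e j (g i) hj' (hg i)] at h
  refine h.trans ?_
  have p1 : (0 : ℝ) ≤ 1 / (((n : ℝ) + j) / n) := by positivity
  have p2 : (0 : ℝ) ≤ 1 / (((n : ℝ) + j) / j) := by positivity
  have h1 := Real.rpow_le_rpow (Finset.sum_nonneg fun i _ => pow_nonneg (hf i) _) hfa p1
  have h2 := Real.rpow_le_rpow (Finset.sum_nonneg fun i _ => pow_nonneg (hg i) _) hgb p2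
  refine (mul_le_mul h1 h2 (Real.rpow_nonneg
    (Finset.sum_nonneg fun i _ => pow_nonneg (hg i) _) _) (by positivity)).trans (le_of_eq ?_)
  rw [Real.mul_rpow hM (by positivity), Real.mul_rpow hM (by positivity), e' n a hn' ha,
    e' j b hj' hb]
  have h3 : M ^ (1 / (((n : ℝ) + j) / n)) * M ^ (1 / (((n : ℝ) + j) / j)) = M := by
    have h4 : 1 / (((n : ℝ) + j) / n) + 1 / (((n : ℝ) + j) / j) = 1 := by field_simp
    rw [← Real.rpow_add' hM (by rw [h4]; exact one_ne_zero), h4, Real.rpow_one]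
  linear_combination (a ^ n * b ^ j) * h3

/-- The exponential sum on the torus with coefficients `f` on the Boolean cube. -/
noncomputable def cubeSum {ι : Type*} {d : ℕ} (z : ι → ℂ) (f : (Fin d → Bool) → ℂ)
    (ω : Fin d → ι) : ℂ :=
  ∑ x, f x * ∏ i, (if x i then z (ω i) else 1)

theorem sum_boolCube_succ {M : Type*} [AddCommMonoid M] {d : ℕ} (g : (Fin (d + 1) → Bool) → M) :
    ∑ x, g x = ∑ x : Fin d → Bool, g (Fin.cons false x)
      + ∑ x : Fin d → Bool, g (Fin.cons true x) := by
  rw [← (Fin.consEquiv fun _ => Bool).sum_comp g, Fintype.sum_prod_type, Fintype.sum_bool, add_comm]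
  rfl

theorem cubeSum_cons {ι : Type*} {d : ℕ} (z : ι → ℂ) (f : (Fin (d + 1) → Bool) → ℂ) (e : ι)
    (ω : Fin d → ι) : cubeSum z f (Fin.cons e ω)
      = cubeSum z (fun x => f (Fin.cons false x)) ω
        + cubeSum z (fun x => f (Fin.cons true x)) ω * z e := by
  unfold cubeSum
  rw [sum_boolCube_succ, Finset.sum_mul]
  congr 1 <;> refine Finset.sum_congr rfl fun x _ => ?_
  · rw [Fin.prod_univ_succ]; simp
  · rw [Fin.prod_univ_succ]; simp; ring

/-- A hypercontractive estimate from ℓ^(2k/p) to L^(2k) that tensorises: splitting off one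
coordinate writes the sum as F + Gz, and the two-point inequality with a = S0^(p/k), b = S1^(p/k)
returns (S0 + S1)^p. -/
theorem sum_norm_cubeSum_pow_le {ι : Type*} [Fintype ι] {k : ℕ} (hk : 2 ≤ k) {p : ℝ}
    (hp : p = Real.logb 2 ((2 * k).choose k : ℕ)) {z : ι → ℂ} (hz : IsOrthogonalSystem k z)
    (d : ℕ) (f : (Fin d → Bool) → ℂ) :
    ∑ ω : Fin d → ι, (‖cubeSum z f ω‖ ^ 2) ^ k
      ≤ (Fintype.card ι : ℝ) ^ d * (∑ x, ‖f x‖ ^ (2 * k / p)) ^ p := by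
  have hk0 : (0 : ℝ) < k := by exact_mod_cast (by omega : 0 < k)
  have hp0 : 0 < p := by rw [hp]; exact hk0.trans (lt_logb_choose hk).1
  induction d with
  | zero =>
    simp only [cubeSum, Finset.univ_unique, Finset.sum_singleton, Finset.univ_eq_empty,
      Finset.prod_empty, mul_one, pow_zero, one_mul]
    rw [← Real.rpow_mul (norm_nonneg _), div_mul_cancel₀ _ hp0.ne', ← pow_mul]
    exact_mod_cast le_rfl
  | succ d ih =>
    set f0 : (Fin d → Bool) → ℂ := fun x => f (Fin.cons false x) with hf0
    set f1 : (Fin d → Bool) → ℂ := fun x => f (Fin.cons true x) with hf1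
    set S0 := ∑ x, ‖f0 x‖ ^ (2 * k / p) with hS0
    set S1 := ∑ x, ‖f1 x‖ ^ (2 * k / p) with hS1
    have hS0' : 0 ≤ S0 := Finset.sum_nonneg fun x _ => Real.rpow_nonneg (norm_nonneg _) _
    have hS1' : 0 ≤ S1 := Finset.sum_nonneg fun x _ => Real.rpow_nonneg (norm_nonneg _) _
    have hpow : ∀ S : ℝ, 0 ≤ S → (S ^ (p / k)) ^ k = S ^ p := fun S hS => by
      rw [← Real.rpow_natCast, ← Real.rpow_mul hS, div_mul_cancel₀ _ hk0.ne']
    have hpow' : ∀ S : ℝ, 0 ≤ S → (S ^ (p / k)) ^ (k / p) = S := fun S hS => by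
      rw [← Real.rpow_mul hS, div_mul_div_cancel₀ hk0.ne', div_self hp0.ne', Real.rpow_one]
    have h1 : ∑ ω : Fin (d + 1) → ι, (‖cubeSum z f ω‖ ^ 2) ^ k
        = Fintype.card ι * ∑ j ∈ Finset.range (k + 1), (k.choose j : ℝ) ^ 2 *
          ∑ ω : Fin d → ι, (‖cubeSum z f0 ω‖ ^ 2) ^ (k - j) * (‖cubeSum z f1 ω‖ ^ 2) ^ j := by
      rw [← (Fin.consEquiv fun _ => ι).sum_comp, Fintype.sum_prod_type, Finset.sum_comm]
      have : ∀ ω : Fin d → ι, ∑ e : ι,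
          (‖cubeSum z f ((Fin.consEquiv fun _ => ι) (e, ω))‖ ^ 2) ^ k
          = Fintype.card ι * ∑ j ∈ Finset.range (k + 1), (k.choose j : ℝ) ^ 2 *
            ((‖cubeSum z f0 ω‖ ^ 2) ^ (k - j) * (‖cubeSum z f1 ω‖ ^ 2) ^ j) := by
        intro ω
        rw [← sum_norm_add_mul_pow hz]
        exact Finset.sum_congr rfl fun e _ => by rw [← cubeSum_cons]; rfl
      rw [Finset.sum_congr rfl fun ω _ => this ω, ← Finset.mul_sum, Finset.sum_comm]
      simp only [Finset.mul_sum]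
    have h2 : ∀ j ∈ Finset.range (k + 1), (k.choose j : ℝ) ^ 2 *
          ∑ ω : Fin d → ι, (‖cubeSum z f0 ω‖ ^ 2) ^ (k - j) * (‖cubeSum z f1 ω‖ ^ 2) ^ j
        ≤ (Fintype.card ι : ℝ) ^ d *
          ((k.choose j : ℝ) ^ 2 * ((S0 ^ (p / k)) ^ (k - j) * (S1 ^ (p / k)) ^ j)) := by
      intro j hj
      have := sum_pow_mul_pow_le Finset.univ (fun ω : Fin d → ι => sq_nonneg ‖cubeSum z f0 ω‖)
        (fun ω => sq_nonneg ‖cubeSum z f1 ω‖) (Nat.lt_succ_iff.1 (Finset.mem_range.1 hj))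
        (M := (Fintype.card ι : ℝ) ^ d) (a := S0 ^ (p / k)) (b := S1 ^ (p / k))
        (by positivity) (by positivity) (by positivity)
        (by rw [hpow S0 hS0']; exact ih f0) (by rw [hpow S1 hS1']; exact ih f1)
      rw [mul_left_comm]
      exact mul_le_mul_of_nonneg_left this (by positivity)
    have h3 := sum_choose_sq_mul_pow_mul_pow_le hk hp (a := S0 ^ (p / k)) (b := S1 ^ (p / k))
      (by positivity) (by positivity)
    rw [hpow' S0 hS0', hpow' S1 hS1'] at h3
    rw [h1, sum_boolCube_succ (fun x => ‖f x‖ ^ (2 * k / p)), pow_succ', mul_assoc]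
    refine mul_le_mul_of_nonneg_left ?_ (by positivity)
    refine (Finset.sum_le_sum h2).trans ?_
    rw [← Finset.mul_sum]
    exact mul_le_mul_of_nonneg_left h3 (by positivity)

/-- The embedding of the Boolean cube in `ℤ^d`. -/
def boolCubeEmbedding (d : ℕ) : (Fin d → Bool) ↪ (Fin d → ℤ) where
  toFun x i := if x i then 1 else 0
  inj' x y h := by
    funext i
    have := congrFun h i
    cases hx : x i <;> cases hy : y i <;> simp [hx, hy] at this ⊢

@[simp]
theorem boolCubeEmbedding_apply {d : ℕ} (x : Fin d → Bool) (i : Fin d) :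
    boolCubeEmbedding d x i = if x i then 1 else 0 := rfl

theorem sum_eq_sum_boolCube {M : Type*} [AddCommMonoid M] {d : ℕ} {A : Finset (Fin d → ℤ)}
    (hA : A ⊆ discreteCube d) (g : (Fin d → ℤ) → M) :
    ∑ a ∈ A, g a = ∑ x, if boolCubeEmbedding d x ∈ A then g (boolCubeEmbedding d x) else 0 := by
  rw [← Finset.sum_filter, ← Finset.sum_map _ (boolCubeEmbedding d) g]
  congr 1
  ext a
  simp only [Finset.mem_map, Finset.mem_filter, Finset.mem_univ, true_and]
  constructor
  · intro ha
    have : boolCubeEmbedding d (fun i => decide (a i = 1)) = a := by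
      funext i
      rcases mem_discreteCube.1 (hA ha) i with h | h <;> simp [h]
    exact ⟨_, by rwa [this], this⟩
  · rintro ⟨x, hx, rfl⟩
    exact hx

theorem kAdditiveEnergy_le_card_rpow {k : ℕ} (hk : 2 ≤ k) {d : ℕ} {A : Finset (Fin d → ℤ)}
    (hA : A ⊆ discreteCube d) :
    (kAdditiveEnergy k A : ℝ) ≤ (A.card : ℝ) ^ Real.logb 2 ((2 * k).choose k : ℕ) := by
  obtain ⟨z, hz⟩ := exists_isOrthogonalSystem k
  have hk0 : (0 : ℝ) < k := by exact_mod_cast (by omega : 0 < k)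
  set p := Real.logb 2 ((2 * k).choose k : ℕ) with hp
  have hp0 : 0 < p := hk0.trans (lt_logb_choose hk).1
  have h := sum_norm_cubeSum_pow_le hk hp hz d
    (fun x => if boolCubeEmbedding d x ∈ A then 1 else 0)
  have h1 := sum_norm_pow_eq_kAdditiveEnergy hz hA
  have h2 : ∀ ω, ∑ a ∈ A, torusMonomial z ω (fun i => (a i).toNat)
      = cubeSum z (fun x => if boolCubeEmbedding d x ∈ A then 1 else 0) ω := by
    intro ω
    rw [sum_eq_sum_boolCube hA]
    refine Finset.sum_congr rfl fun x _ => ?_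
    simp only
    split_ifs with hx
    · rw [one_mul]
      refine Finset.prod_congr rfl fun i _ => ?_
      cases hxi : x i <;> simp [hxi]
    · rw [zero_mul]
  have h3 : ∑ x : Fin d → Bool, ‖(if boolCubeEmbedding d x ∈ A then 1 else 0 : ℂ)‖ ^ (2 * k / p)
      = A.card := by
    have := sum_eq_sum_boolCube hA (fun _ => (1 : ℝ))
    rw [Finset.sum_const, nsmul_eq_mul, mul_one] at this
    rw [this]
    refine Finset.sum_congr rfl fun x _ => ?_
    split_ifs
    · simp
    -- The exponent 2k/p is positive, so points outside A contribute 0.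
    · rw [norm_zero, Real.zero_rpow (by positivity)]
  simp only [← h2] at h
  rw [h3, h1] at h
  exact le_of_mul_le_mul_left h (by simp; positivity)

/-! ### Sumsets of the cube and the case of two summands -/

theorem card_discreteCube (d : ℕ) : (discreteCube d).card = 2 ^ d := by
  simp [discreteCube, Fintype.card_piFinset]

theorem card_iteratedSumset_discreteCube_le (k d : ℕ) :
    (iteratedSumset k (discreteCube d)).card ≤ (k + 1) ^ d := by
  have h : iteratedSumset k (discreteCube d)
      ⊆ Fintype.piFinset fun _ : Fin d => Finset.Icc (0 : ℤ) k := by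
    intro x hx
    obtain ⟨a, ha, rfl⟩ := mem_familySumset.1 hx
    refine Fintype.mem_piFinset.2 fun i => Finset.mem_Icc.2 ?_
    rw [Finset.sum_apply]
    have h01 : ∀ j, 0 ≤ a j i ∧ a j i ≤ 1 := fun j => by
      rcases mem_discreteCube.1 (ha j) i with h | h <;> simp [h]
    refine ⟨Finset.sum_nonneg fun j _ => (h01 j).1, ?_⟩
    calc ∑ j, a j i ≤ ∑ j : Fin k, (1 : ℤ) := Finset.sum_le_sum fun j _ => (h01 j).2
      _ = k := by simp
  refine (Finset.card_le_card h).trans (le_of_eq ?_)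
  simp [Fintype.card_piFinset]

theorem card_le_card_iteratedSumset {G : Type*} [AddCommGroup G] [DecidableEq G] {k : ℕ}
    (hk : 1 ≤ k) (A : Finset G) : A.card ≤ (iteratedSumset k A).card := by
  rcases A.eq_empty_or_nonempty with rfl | ⟨b, hb⟩
  · simp
  obtain ⟨n, rfl⟩ := Nat.exists_eq_add_of_le' hk
  refine Finset.card_le_card_of_injOn (fun a => a + n • b) ?_ fun x _ y _ h => add_right_cancel h
  intro a ha
  refine Finset.mem_coe.2 (mem_familySumset.2 ⟨Fin.cons a fun _ => b, fun i => ?_, ?_⟩)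
  · refine Fin.cases ?_ (fun i => ?_) i
    · exact ha
    · exact hb
  · rw [Fin.sum_univ_succ]; simp

theorem iteratedSumset_two {G : Type*} [AddCommGroup G] [DecidableEq G] (A : Finset G) :
    iteratedSumset 2 A = A + A := by
  ext x
  rw [Finset.mem_add]
  refine mem_familySumset.trans ⟨?_, ?_⟩
  · rintro ⟨a, ha, rfl⟩
    exact ⟨a 0, ha 0, a 1, ha 1, (Fin.sum_univ_two a).symm⟩
  · rintro ⟨a, ha, b, hb, rfl⟩
    exact ⟨![a, b], by simp [Fin.forall_fin_two, ha, hb], by simp⟩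

theorem kAdditiveEnergy_two {G : Type*} [AddCommGroup G] [DecidableEq G] (A : Finset G) :
    kAdditiveEnergy 2 A = Finset.addEnergy A A := by
  unfold kAdditiveEnergy Finset.addEnergy
  refine Finset.card_bij'
    -- `Finset.addEnergy` counts ((a₁, a₂), (b₁, b₂)) with a₁ + b₁ = a₂ + b₂, so the two sides of
    -- the equation are interleaved.
    (fun x _ => ((x.1 0, x.2 0), (x.1 1, x.2 1)))
    (fun y _ => (![y.1.1, y.2.1], ![y.1.2, y.2.2])) ?_ ?_ ?_ ?_
  · rintro ⟨a, b⟩ h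
    simp only [Finset.mem_filter, Finset.mem_product, Fintype.mem_piFinset, Fin.forall_fin_two,
      Fin.sum_univ_two] at h ⊢
    tauto
  · rintro ⟨⟨a, b⟩, c, e⟩ h
    simp only [Finset.mem_filter, Finset.mem_product, Fintype.mem_piFinset, Fin.forall_fin_two,
      Fin.sum_univ_two, Matrix.cons_val_zero, Matrix.cons_val_one] at h ⊢
    tauto
  · rintro ⟨a, b⟩ _
    ext i <;> fin_cases i <;> rfl
  · rintro ⟨⟨a, b⟩, c, e⟩ _
    rfl

theorem kAdditiveEnergy_le_rpow {d k : ℕ} (hk : 2 ≤ k) {A : Finset (Fin d → ℤ)}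
    (hA : A ⊆ discreteCube d) (hne : A.Nonempty) :
    (kAdditiveEnergy k A : ℝ) ≤ (((iteratedSumset k A).card : ℝ) / (A.card : ℝ)) ^
      Real.logb (((k : ℝ) + 1) / 2) ((Nat.choose (2 * k) k : ℕ) : ℝ) := by
  have hk2 : (2 : ℝ) ≤ k := by exact_mod_cast hk
  have hcard : (0 : ℝ) < A.card := by exact_mod_cast hne.card_pos
  have hb : (1 : ℝ) < (k + 1) / 2 := by linarith
  have hC : (1 : ℝ) < ((2 * k).choose k : ℕ) := by
    have := two_pow_lt_choose_two_mul hk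
    exact_mod_cast (Nat.one_le_two_pow).trans_lt this
  have h2 : (A.card : ℝ) ^ Real.logb 2 (((k : ℝ) + 1) / 2) ≤ (iteratedSumset k A).card / A.card := by
    rw [Real.logb_div (by positivity) two_ne_zero, Real.logb_self_eq_one one_lt_two,
      Real.rpow_sub hcard, Real.rpow_one]
    exact div_le_div_of_nonneg_right (card_rpow_le_card_iteratedSumset hk hA) hcard.le
  refine (kAdditiveEnergy_le_card_rpow hk hA).trans ?_
  refine le_trans (le_of_eq ?_)
    (Real.rpow_le_rpow (by positivity) h2 (Real.logb_pos hb hC).le)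
  -- Chain rule for logarithms: log₂((k+1)/2) times the exponent p is log₂ C(2k,k).
  rw [← Real.rpow_mul hcard.le, Real.mul_logb (by positivity) hb.ne' (by linarith)]

theorem mainTheorem5 (d k : ℕ) (hd : 1 ≤ d) (hk : 2 ≤ k) :
    (∀ A : Finset (Fin d → ℤ), A ⊆ discreteCube d → A.Nonempty →
      (kAdditiveEnergy k A : ℝ) ≤
        (((iteratedSumset k A).card : ℝ) / (A.card : ℝ)) ^
          Real.logb (((k : ℝ) + 1) / 2) ((Nat.choose (2 * k) k : ℕ) : ℝ)) ∧
    (∀ q : ℝ, q < Real.logb (((k : ℝ) + 1) / 2) ((Nat.choose (2 * k) k : ℕ) : ℝ) →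
      ∃ A : Finset (Fin d → ℤ), A ⊆ discreteCube d ∧ A.Nonempty ∧
        (((iteratedSumset k A).card : ℝ) / (A.card : ℝ)) ^ q < (kAdditiveEnergy k A : ℝ)) ∧
    (∀ A : Finset (Fin d → ℤ), A ⊆ discreteCube d → A.Nonempty →
      (Finset.addEnergy A A : ℝ) ≤
        (((A + A).card : ℝ) / (A.card : ℝ)) ^ Real.logb (3 / 2 : ℝ) 6) := by
  refine ⟨fun A hA hne => kAdditiveEnergy_le_rpow hk hA hne, fun q hq => ?_, fun A hA hne => ?_⟩
  · have hk2 : (2 : ℝ) ≤ k := by exact_mod_cast hk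
    have hb : (1 : ℝ) < (k + 1) / 2 := by linarith
    have hC : (1 : ℝ) < ((2 * k).choose k : ℕ) := by
      have := two_pow_lt_choose_two_mul hk
      exact_mod_cast (Nat.one_le_two_pow).trans_lt this
    have hcard := card_discreteCube d
    have hpos : 0 < (discreteCube d).card := by rw [hcard]; positivity
    refine ⟨discreteCube d, Finset.Subset.refl _, Finset.card_pos.1 hpos, ?_⟩
    -- A negative q would reverse the upper bound `h2` on the ratio. As the ratio is at least 1 and
    -- p > 0, q may be raised to max q 0.
    have hm : max q 0 < Real.logb (((k : ℝ) + 1) / 2) ((Nat.choose (2 * k) k : ℕ) : ℝ) :=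
      max_lt hq (Real.logb_pos hb hC)
    have hpos' : (0 : ℝ) < (discreteCube d).card := by exact_mod_cast hpos
    have h1 : (1 : ℝ) ≤ (iteratedSumset k (discreteCube d)).card / (discreteCube d).card := by
      rw [one_le_div hpos']
      exact_mod_cast card_le_card_iteratedSumset (by omega) (discreteCube d)
    have h2 : ((iteratedSumset k (discreteCube d)).card : ℝ) / (discreteCube d).card
        ≤ ((k + 1) / 2) ^ d := by
      rw [div_pow, hcard]; push_cast
      refine div_le_div_of_nonneg_right ?_ (by positivity)
      exact_mod_cast card_iteratedSumset_discreteCube_le k d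
    rw [kAdditiveEnergy_discreteCube]
    calc (((iteratedSumset k (discreteCube d)).card : ℝ) / (discreteCube d).card) ^ q
        ≤ (((iteratedSumset k (discreteCube d)).card : ℝ) / (discreteCube d).card) ^ max q 0 :=
          Real.rpow_le_rpow_of_exponent_le h1 (le_max_left _ _)
      _ ≤ ((((k : ℝ) + 1) / 2) ^ d) ^ max q 0 :=
          Real.rpow_le_rpow (by linarith) h2 (le_max_right _ _)
      _ = ((((k : ℝ) + 1) / 2) ^ max q 0) ^ d := by
          rw [← Real.rpow_natCast, ← Real.rpow_natCast, ← Real.rpow_mul (by positivity),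
            ← Real.rpow_mul (by positivity), mul_comm]
      _ < (((2 * k).choose k : ℕ) : ℝ) ^ d := by
          -- Strictness survives the d-th power because d ≥ 1.
          refine pow_lt_pow_left₀ ?_ (by positivity) (by omega)
          exact (Real.lt_logb_iff_rpow_lt hb (by linarith)).1 hm
      _ = (((2 * k).choose k ^ d : ℕ) : ℝ) := by push_cast; rfl
  · have h := kAdditiveEnergy_le_rpow le_rfl hA hne
    rw [kAdditiveEnergy_two, iteratedSumset_two] at h
    have h6 : ((Nat.choose (2 * 2) 2 : ℕ) : ℝ) = 6 := by norm_num [Nat.choose]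
    rw [h6] at h
    norm_num at h ⊢
    exact h
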